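/- **Setting.** Let $I\subseteq\mathbb{R}$ be a nonempty open interval, $d\ge 1$, $(T,\mathcal{A})$ a measurable space and $\mu$ a probability measure on it. For $f,g:I\to\mathbb{R}$ put $\mathcal{D}_{f,g}(x,y):=f(x)g(y)-f(y)g(x)$ and $W_{f,g}:=f'g-fg'$. For $n\in\{1,2,3\}$, let $\mathcal{C}_n(I)$ be the class of pairs $(f,g)$ of $n$ times continuously differentiable functions on $I$ such that $\mathcal{D}_{f,g}(x,y)\ne0$ for all distinct $x,y\in I$ (that is, $(f,g)$ is a Chebyshev system) and $W_{f,g}$ does not vanish on $I$. For $(f,g)\in\mathcal{C}_2(I)$ put $$\Phi_{f,g}:=\frac{f''g-fg''}{f'g-fg'},\qquad \Psi_{f,g}:=-\frac{f''g'-f'g''}{f'g-fg'} .$$ A *measurable family of $d$-variable means* is a map $m:I^d\times T\to I$ such that $m(\boldsymbol{x},\cdot)$ is measurable for every $\boldsymbol{x}\in I^d$ and $\min_i x_i\le m(\boldsymbol{x},t)\le\max_i x_i$ for all $\boldsymbol{x}\in I^d$, $t\in T$. For $q\ge1$, a function $\varphi:I^d\times T\to\mathbb{R}$ is of *$L^q$-type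 at* $\boldsymbol{p}\in I^d$ if $\varphi(\boldsymbol{p},\cdot)$ is measurable and there are $\delta>0$ and a measurable $a:T\to\mathbb{R}$ with $|a|^q$ $\mu$-integrable such that $|\varphi(\boldsymbol{x},t)|\le a(t)$ for all $t\in T$ and all $\boldsymbol{x}\in I^d$ with $|\boldsymbol{x}-\boldsymbol{p}|\le\delta$. Partial derivatives $\partial_i$ are taken with respect to the coordinates of $\boldsymbol{x}$. * $\mathcal{C}_1(I^d\times T)$ is the class of measurable families of $d$-variable means $m$ such that each $m(\cdot,t)$ is continuously differentiable on $I^d$ and, for all $i$ and all $\boldsymbol{p}\in I^d$, $\partial_im$ is of $L^1$-type at $\boldsymbol{p}$. * $\mathcal{C}_2(I^d\times T)$ is the class of $m\in\mathcal{C}_1(I^d\times T)$ such that each $m(\cdot,t)$ is twice continuously differentiable and, for all $i,j$ and all $\boldsymbol{p}$, $\partial_im$ is of $L^2$-type and $\partial_i\partial_jm$ of $L^1$-type at $\boldsymbol{p}$. * $\mathcal{C}_3(I^d\times T)$ is the class of $m\in\mathcal{C}_2(I^d\times T)$ such that each $m(\cdot,t)$ is three times continuously differentiable and, for all $i,j,l$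 and all $\boldsymbol{p}$, $\partial_im$ is of $L^3$-type, $\partial_i\partial_jm$ of $L^{3/2}$-type and $\partial_i\partial_j\partial_lm$ of $L^1$-type at $\boldsymbol{p}$. For $\boldsymbol{x}\in I^d$, let $M(\boldsymbol{x})=M_{f,g,m;\mu}(\boldsymbol{x})$ denote the unique $y\in I$ with $\int_T\mathcal{D}_{f,g}(m(\boldsymbol{x},t),y)\,d\mu(t)=0$. Write $\langle\varphi\rangle_\mu(\boldsymbol{x}):=\int_T\varphi(\boldsymbol{x},t)\,d\mu(t)$, $\partial_i^*m:=\partial_im-\langle\partial_im\rangle_\mu$ and $x^{(d)}:=(x,\dots,x)\in I^d$. **Theorem.** Let $f,g:I\to\mathbb{R}$ and $m:I^d\times T\to I$. 1. If $(f,g)\in\mathcal{C}_1(I)$ and $m\in\mathcal{C}_1(I^d\times T)$, then $M$ is continuously differentiable on $I^d$ and, for all $i\in\{1,\dots,d\}$ and $x\in I$, $$\partial_iM(x^{(d)})=\langle\partial_im\rangle_\mu(x^{(d)}).$$ 2. If $(f,g)\in\mathcal{C}_2(I)$ and $m\in\mathcal{C}_2(I^d\times T)$, then $M$ is twice continuously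 differentiable on $I^d$ and, for all $i,j\in\{1,\dots,d\}$ and $x\in I$, $$\partial_i\partial_jM(x^{(d)})=\Phi_{f,g}(x)\,\langle\partial_i^*m\,\partial_j^*m\rangle_\mu(x^{(d)})+\langle\partial_i\partial_jm\rangle_\mu(x^{(d)}).$$ 3. If $(f,g)\in\mathcal{C}_3(I)$ and $m\in\mathcal{C}_3(I^d\times T)$, then $M$ is three times continuously differentiable on $I^d$ and, for all $i,j,l\in\{1,\dots,d\}$ and $x\in I$, $$\begin{aligned}\partial_i\partial_j\partial_lM(x^{(d)})={}&\big(\Phi_{f,g}'(x)+\Phi_{f,g}^2(x)\big)\big(\langle\partial_im\,\partial_jm\,\partial_lm\rangle_\mu-\langle\partial_im\rangle_\mu\langle\partial_jm\rangle_\mu\langle\partial_lm\rangle_\mu\big)(x^{(d)})\\&+\Phi_{f,g}(x)\sum_{(\alpha,\beta,\gamma)}\big(\langle\partial_\alpha\partial_\beta m\,\partial_\gamma m\rangle_\mu-\partial_\alpha\partial_\beta M\,\partial_\gamma M\big)(x^{(d)})\\&+\Psi_{f,g}(x)\,\langle\partial_i^*m\,\partial_j^*m\,\partial_l^*m\rangle_\mu(x^{(d)})+\langle\partial_i\partial_j\partial_lm\rangle_\mu(x^{(d)}),\end{aligned}$$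 where the sum has three terms, one for each of the cyclic rearrangements $(i,j,l)$, $(j,l,i)$, $(l,i,j)$ (three terms also when $i=j=l$). -/

import Mathlib

open MeasureTheory

noncomputable section

namespace GenMean

/-- The determinant `D_{f,g}(x,y) = f(x) g(y) - f(y) g(x)`. -/
def chebDet (f g : ℝ → ℝ) (x y : ℝ) : ℝ := f x * g y - f y * g x

/-- The Wronski determinant `f'(x) g(x) - f(x) g'(x)`. -/
def wronskian (f g : ℝ → ℝ) (x : ℝ) : ℝ := deriv f x * g x - f x * deriv g x

/-- `(f, g)` is a (two-dimensional) Chebyshev system on `I`. -/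
def IsChebyshev (I : Set ℝ) (f g : ℝ → ℝ) : Prop :=
  ContinuousOn f I ∧ ContinuousOn g I ∧
    ∀ x ∈ I, ∀ y ∈ I, x ≠ y → chebDet f g x y ≠ 0

/-- The class `𝒞_n(I)` of generating pairs: `n` times continuously differentiable Chebyshev
systems on `I` whose Wronski determinant (if `n ≥ 1`) does not vanish on `I`. -/
structure PairClass (n : ℕ) (I : Set ℝ) (f g : ℝ → ℝ) : Prop where
  chebyshev : IsChebyshev I f g
  contDiff_left : ContDiffOn ℝ n f I
  contDiff_right : ContDiffOn ℝ n g I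
  wronskian_ne_zero : 1 ≤ n → ∀ x ∈ I, wronskian f g x ≠ 0

/-- `Φ_{f,g} = (f'' g - f g'') / (f' g - f g')`. -/
def Phi (f g : ℝ → ℝ) (x : ℝ) : ℝ :=
  (iteratedDeriv 2 f x * g x - f x * iteratedDeriv 2 g x) / wronskian f g x

/-- `Ψ_{f,g} = - (f'' g' - f' g'') / (f' g - f g')`. -/
def Psi (f g : ℝ → ℝ) (x : ℝ) : ℝ :=
  -((iteratedDeriv 2 f x * deriv g x - deriv f x * iteratedDeriv 2 g x) / wronskian f g x)

variable {d : ℕ} {T : Type*}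

/-- The cube `I^d`. -/
def cube (d : ℕ) (I : Set ℝ) : Set (Fin d → ℝ) := {x | ∀ i, x i ∈ I}

/-- `M` is a `d`-variable mean on `I` (for `d ≥ 1`): it maps `I^d` to `I` and has the mean value
property `min (x₁, …, x_d) ≤ M x ≤ max (x₁, …, x_d)`. -/
def IsMean (I : Set ℝ) (M : (Fin d → ℝ) → ℝ) : Prop :=
  ∀ x ∈ cube d I, M x ∈ I ∧ (⨅ i, x i) ≤ M x ∧ M x ≤ ⨆ i, x i

/-- `m : I^d × T → I` is a measurable family of `d`-variable means on `I`. -/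
def IsMeasurableFamily [MeasurableSpace T] (I : Set ℝ) (m : (Fin d → ℝ) → T → ℝ) : Prop :=
  (∀ t, IsMean I fun x => m x t) ∧ ∀ x ∈ cube d I, Measurable (m x)

/-- The `i`-th partial derivative `∂ᵢ F` of a function of `d` variables. -/
def pderiv (i : Fin d) (F : (Fin d → ℝ) → ℝ) (x : Fin d → ℝ) : ℝ :=
  lineDeriv ℝ F x (Pi.single i 1)

/-- The partial derivative `∂ᵢ φ` of `φ : I^d × T → ℝ` in its `i`-th spatial variable. -/
def pd (i : Fin d) (φ : (Fin d → ℝ) → T → ℝ) (x : Fin d → ℝ) (t : T) : ℝ :=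
  pderiv i (fun y => φ y t) x

/-- `φ : I^d × T → ℝ` is of `L^q`-type at `p`. -/
def IsLType [MeasurableSpace T] (μ : Measure T) (q : ENNReal) (I : Set ℝ)
    (φ : (Fin d → ℝ) → T → ℝ) (p : Fin d → ℝ) : Prop :=
  Measurable (φ p) ∧ ∃ δ : ℝ, 0 < δ ∧ ∃ a : T → ℝ, Measurable a ∧ MemLp a q μ ∧
    ∀ t, ∀ x ∈ cube d I, x ∈ Metric.closedBall p δ → |φ x t| ≤ a t

/-- The class `𝒞₁(I^d × T)`. -/
structure FamilyClass1 [MeasurableSpace T] (μ : Measure T) (I : Set ℝ)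
    (m : (Fin d → ℝ) → T → ℝ) : Prop where
  family : IsMeasurableFamily I m
  contDiff_one : ∀ t, ContDiffOn ℝ 1 (fun x => m x t) (cube d I)
  type_one : ∀ p ∈ cube d I, ∀ i, IsLType μ 1 I (pd i m) p

/-- The class `𝒞₂(I^d × T)`. -/
structure FamilyClass2 [MeasurableSpace T] (μ : Measure T) (I : Set ℝ)
    (m : (Fin d → ℝ) → T → ℝ) : Prop extends FamilyClass1 μ I m where
  contDiff_two : ∀ t, ContDiffOn ℝ 2 (fun x => m x t) (cube d I)
  type_two : ∀ p ∈ cube d I, ∀ i j,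
    IsLType μ 2 I (pd i m) p ∧ IsLType μ 1 I (pd i (pd j m)) p

/-- The class `𝒞₃(I^d × T)`. -/
structure FamilyClass3 [MeasurableSpace T] (μ : Measure T) (I : Set ℝ)
    (m : (Fin d → ℝ) → T → ℝ) : Prop extends FamilyClass2 μ I m where
  contDiff_three : ∀ t, ContDiffOn ℝ 3 (fun x => m x t) (cube d I)
  type_three : ∀ p ∈ cube d I, ∀ i j l,
    IsLType μ 3 I (pd i m) p ∧ IsLType μ (3 / 2) I (pd i (pd j m)) p ∧
      IsLType μ 1 I (pd i (pd j (pd l m))) p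

/-- The mean value `⟨φ⟩_μ (x) = ∫ φ(x,t) dμ(t)`. -/
def avg [MeasurableSpace T] (μ : Measure T) (φ : (Fin d → ℝ) → T → ℝ) (x : Fin d → ℝ) : ℝ :=
  ∫ t, φ x t ∂μ

/-- The centred partial derivative `∂ᵢ* m = ∂ᵢ m - ⟨∂ᵢ m⟩_μ`. -/
def pdStar [MeasurableSpace T] (μ : Measure T) (i : Fin d) (m : (Fin d → ℝ) → T → ℝ)
    (x : Fin d → ℝ) (t : T) : ℝ :=
  pd i m x t - avg μ (pd i m) x

/-- The mean `M_{f,g,m;μ}`: for `x ∈ I^d`, the (unique) solution `y ∈ I` of the equation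
`∫ D_{f,g}(m(x,t), y) dμ(t) = 0`. -/
def genMean [MeasurableSpace T] (I : Set ℝ) (f g : ℝ → ℝ) (m : (Fin d → ℝ) → T → ℝ)
    (μ : Measure T) (x : Fin d → ℝ) : ℝ :=
  Classical.epsilon fun y => y ∈ I ∧ ∫ t, chebDet f g (m x t) y ∂μ = 0

/-- The diagonal point `(x, …, x)`. -/
def diag (d : ℕ) (x : ℝ) : Fin d → ℝ := fun _ => x

/-- The sum over the three cyclic rearrangements `(i,j,l)`, `(j,l,i)`, `(l,i,j)`, counted as a
family (three summands even if `i = j = l`). -/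
def cyclicSum (F : Fin d → Fin d → Fin d → ℝ) (i j l : Fin d) : ℝ :=
  F i j l + F j l i + F l i j

end GenMean

end

/-!
For `x ∈ I^d` put `A(x) = ⟨f ∘ m⟩(x)` and `B(x) = ⟨g ∘ m⟩(x)`. Since
`∫ D(m(x,t), y) dμ(t) = A(x) g(y) - f(y) B(x)`, the mean `M(x)` is the solution `y ∈ I` of
`A(x) g(y) = B(x) f(y)`. It exists by the intermediate value theorem, because the determinant of a
Chebyshev system has constant sign below the diagonal (`IsChebyshev.exists_sign`). It is unique
because `A(x)` and `B(x)` do not vanish simultaneously (`avg_ne_zero`).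

*Smoothness.* Hölder's inequality turns the `L^q`-type conditions on the derivatives of `m` into
`L¹`-type conditions on those of `k ∘ m` for `k = f, g` (`FamilyClass3.hasL1Jet_comp` and its lower
order versions), so that `A` and `B` may be differentiated under the integral sign
(`HasL1Jet.contDiffOn_avg`). By uniqueness, `M` agrees near each point with the implicit function of
`A(x) g(y) - f(y) B(x) = 0`; the derivative of the left-hand side in `y` is nonzero because the
Wronski determinant is (`contDiffOn_genMean`).

*Derivatives on the diagonal.* The identity `A · (g ∘ M) = B · (f ∘ M)` is differentiated up to three
times by the product and chain rules. On the diagonal `m(·, t)` and `M` both take the value `x`, so the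
derivatives of `A` and `B` there are combinations of averages of derivatives of `m` whose
coefficients are derivatives of `f` and `g` at `x`. What remains is an equation that is linear in the
highest derivative of `M`, with the Wronski determinant as coefficient. Solving it and rewriting the
outcome in terms of `Φ`, `Φ'`, `Ψ` and centred moments gives the formulas; for the third order one
uses `(Φ' + Φ²) W = f''' g - f g''' + f'' g' - f' g''` (`deriv_Phi_add_sq`).
-/

namespace GenMean

/-! ### Partial derivatives on open sets -/

section Calculus

open Set

variable {d : ℕ} {F G : (Fin d → ℝ) → ℝ} {U : Set (Fin d → ℝ)} {I : Set ℝ} {x : Fin d → ℝ}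

theorem pderiv_eq_fderiv (h : DifferentiableAt ℝ F x) (i : Fin d) :
    pderiv i F x = fderiv ℝ F x (Pi.single i 1) :=
  h.lineDeriv_eq_fderiv

theorem pderiv_eqOn (hU : IsOpen U) (h : EqOn F G U) (i : Fin d) :
    EqOn (pderiv i F) (pderiv i G) U := fun _ hx =>
  Filter.EventuallyEq.lineDeriv_eq (h.eventuallyEq_of_mem (hU.mem_nhds hx))

theorem pderiv_mul (hF : DifferentiableAt ℝ F x) (hG : DifferentiableAt ℝ G x) (i : Fin d) :
    pderiv i (fun y => F y * G y) x = F x * pderiv i G x + pderiv i F x * G x := by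
  rw [pderiv_eq_fderiv (hF.fun_mul hG), pderiv_eq_fderiv hF, pderiv_eq_fderiv hG,
    fderiv_fun_mul hF hG]
  simp
  ring

theorem pderiv_add (hF : DifferentiableAt ℝ F x) (hG : DifferentiableAt ℝ G x) (i : Fin d) :
    pderiv i (fun y => F y + G y) x = pderiv i F x + pderiv i G x := by
  rw [pderiv_eq_fderiv (hF.fun_add hG), pderiv_eq_fderiv hF, pderiv_eq_fderiv hG,
    fderiv_fun_add hF hG]
  simp

theorem pderiv_comp {k : ℝ → ℝ} (hk : DifferentiableAt ℝ k (F x)) (hF : DifferentiableAt ℝ F x)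
    (i : Fin d) : pderiv i (fun y => k (F y)) x = deriv k (F x) * pderiv i F x := by
  have h := (hk.hasDerivAt.hasFDerivAt.comp x hF.hasFDerivAt).hasLineDerivAt (Pi.single i 1)
  have h' := h.lineDeriv
  rw [pderiv_eq_fderiv hF]
  simpa [pderiv, Function.comp_def, mul_comm] using h'

theorem hasFDerivAt_sum_pderiv (hF : DifferentiableAt ℝ F x) :
    HasFDerivAt F (∑ i, pderiv i F x • (ContinuousLinearMap.proj i : (Fin d → ℝ) →L[ℝ] ℝ)) x := by
  have h : ∑ i, pderiv i F x • (ContinuousLinearMap.proj i : (Fin d → ℝ) →L[ℝ] ℝ) =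
      fderiv ℝ F x := by
    refine ContinuousLinearMap.ext fun v => ?_
    conv_rhs => rw [pi_eq_sum_univ' v, map_sum]
    simp [pderiv_eq_fderiv hF, mul_comm]
  exact h ▸ hF.hasFDerivAt

theorem contDiffOn_pderiv (hU : IsOpen U) {m n : WithTop ℕ∞} (hF : ContDiffOn ℝ n F U)
    (hmn : m + 1 ≤ n) (i : Fin d) : ContDiffOn ℝ m (pderiv i F) U := by
  have h := (hF.fderiv_of_isOpen hU hmn).clm_apply
    (contDiffOn_const (c := (Pi.single i 1 : Fin d → ℝ)))
  refine h.congr fun y hy => pderiv_eq_fderiv ?_ i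
  exact (hF.differentiableOn (by rintro rfl; simp at hmn)).differentiableAt (hU.mem_nhds hy)

theorem contDiffOn_succ_of_hasFDerivAt_sum (hU : IsOpen U) {n : ℕ} {A : Fin d → (Fin d → ℝ) → ℝ}
    (hF : ∀ x ∈ U,
      HasFDerivAt F (∑ i, A i x • (ContinuousLinearMap.proj i : (Fin d → ℝ) →L[ℝ] ℝ)) x)
    (hA : ∀ i, ContDiffOn ℝ n (A i) U) : ContDiffOn ℝ (n + 1) F U := by
  rw [contDiffOn_succ_iff_fderiv_of_isOpen hU]
  refine ⟨fun x hx => (hF x hx).differentiableAt.differentiableWithinAt, by simp, ?_⟩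
  have h : ContDiffOn ℝ n
      (fun x => ∑ i, A i x • (ContinuousLinearMap.proj i : (Fin d → ℝ) →L[ℝ] ℝ)) U :=
    ContDiffOn.sum fun i _ => (hA i).smul contDiffOn_const
  exact h.congr fun x hx => (hF x hx).fderiv

theorem pderiv_comm (hU : IsOpen U) (hF : ContDiffOn ℝ 2 F U) (hx : x ∈ U) (i j : Fin d) :
    pderiv i (pderiv j F) x = pderiv j (pderiv i F) x := by
  have key : ∀ i j : Fin d, pderiv i (pderiv j F) x =
      fderiv ℝ (fderiv ℝ F) x (Pi.single i 1) (Pi.single j 1) := by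
    intro i j
    have h1 : EqOn (pderiv j F) (fun y => fderiv ℝ F y (Pi.single j 1)) U := fun y hy =>
      pderiv_eq_fderiv ((hF.differentiableOn two_ne_zero).differentiableAt (hU.mem_nhds hy)) j
    have h2 : DifferentiableAt ℝ (fderiv ℝ F) x :=
      ((hF.fderiv_of_isOpen hU (m := 1) (by norm_num)).differentiableOn
        one_ne_zero).differentiableAt (hU.mem_nhds hx)
    rw [pderiv_eqOn hU h1 i hx, pderiv_eq_fderiv (h2.clm_apply (differentiableAt_const _)),
      fderiv_clm_apply h2 (differentiableAt_const _)]
    simp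
  rw [key, key]
  exact ((hF.contDiffAt (hU.mem_nhds hx)).isSymmSndFDerivAt (by simp)).eq _ _

variable {k : ℝ → ℝ}

theorem pderiv_comp_eqOn (hU : IsOpen U) (hI : IsOpen I) (hk : ContDiffOn ℝ 1 k I)
    (hF : ContDiffOn ℝ 1 F U) (hm : MapsTo F U I) (i : Fin d) :
    EqOn (pderiv i fun y => k (F y)) (fun y => deriv k (F y) * pderiv i F y) U := fun _ hy =>
  pderiv_comp ((hk.differentiableOn one_ne_zero).differentiableAt (hI.mem_nhds (hm hy)))
    ((hF.differentiableOn one_ne_zero).differentiableAt (hU.mem_nhds hy)) i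

theorem pderiv_pderiv_comp_eqOn (hU : IsOpen U) (hI : IsOpen I) (hk : ContDiffOn ℝ 2 k I)
    (hF : ContDiffOn ℝ 2 F U) (hm : MapsTo F U I) (i j : Fin d) :
    EqOn (pderiv i (pderiv j fun y => k (F y)))
      (fun y => deriv (deriv k) (F y) * (pderiv i F y * pderiv j F y) +
        deriv k (F y) * pderiv i (pderiv j F) y) U := fun y hy => by
  have hk' : ContDiffOn ℝ 1 (deriv k) I := hk.deriv_of_isOpen hI (by norm_num)
  have hF1 : ContDiffOn ℝ 1 F U := hF.of_le one_le_two
  have hFj : ContDiffOn ℝ 1 (pderiv j F) U := contDiffOn_pderiv hU hF (by norm_num) j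
  have hd := fun {H : (Fin d → ℝ) → ℝ} (hH : ContDiffOn ℝ 1 H U) =>
    (hH.differentiableOn one_ne_zero).differentiableAt (hU.mem_nhds hy)
  rw [pderiv_eqOn hU (pderiv_comp_eqOn hU hI (hk.of_le one_le_two) hF1 hm j) i hy,
    pderiv_mul (F := fun y => deriv k (F y)) (hd (hk'.comp hF1 hm)) (hd hFj),
    pderiv_comp_eqOn hU hI hk' hF1 hm i hy]
  ring

theorem pderiv_pderiv_pderiv_comp_eqOn (hU : IsOpen U) (hI : IsOpen I) (hk : ContDiffOn ℝ 3 k I)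
    (hF : ContDiffOn ℝ 3 F U) (hm : MapsTo F U I) (i j l : Fin d) :
    EqOn (pderiv i (pderiv j (pderiv l fun y => k (F y))))
      (fun y => deriv (deriv (deriv k)) (F y) * (pderiv i F y * pderiv j F y * pderiv l F y) +
        deriv (deriv k) (F y) * (pderiv i (pderiv j F) y * pderiv l F y +
          pderiv j (pderiv l F) y * pderiv i F y + pderiv l (pderiv i F) y * pderiv j F y) +
        deriv k (F y) * pderiv i (pderiv j (pderiv l F)) y) U := fun y hy => by
  have h23 : (2 : WithTop ℕ∞) ≤ 3 := by norm_num
  have hk1 : ContDiffOn ℝ 2 (deriv k) I := hk.deriv_of_isOpen hI (by norm_num)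
  have hk2 : ContDiffOn ℝ 1 (deriv (deriv k)) I := hk1.deriv_of_isOpen hI (by norm_num)
  have hF2 : ContDiffOn ℝ 2 F U := hF.of_le h23
  have hF1 : ContDiffOn ℝ 1 F U := hF2.of_le one_le_two
  have hFj : ∀ j, ContDiffOn ℝ 1 (pderiv j F) U := contDiffOn_pderiv hU hF2 (by norm_num)
  have hFjl : ContDiffOn ℝ 1 (pderiv j (pderiv l F)) U :=
    contDiffOn_pderiv hU (contDiffOn_pderiv hU hF (m := 2) (by norm_num) l) (by norm_num) j
  have hd := fun {H : (Fin d → ℝ) → ℝ} (hH : ContDiffOn ℝ 1 H U) =>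
    (hH.differentiableOn one_ne_zero).differentiableAt (hU.mem_nhds hy)
  have e1 : DifferentiableAt ℝ (fun y => deriv (deriv k) (F y)) y := hd (hk2.comp hF1 hm)
  have e2 := hd ((hFj j).mul (hFj l))
  have e3 : DifferentiableAt ℝ (fun y => deriv k (F y)) y :=
    hd ((hk1.of_le one_le_two).comp hF1 hm)
  rw [pderiv_eqOn hU (pderiv_pderiv_comp_eqOn hU hI (hk.of_le h23) hF2 hm j l) i hy,
    pderiv_add (e1.fun_mul e2) (e3.fun_mul (hd hFjl)), pderiv_mul e1 e2, pderiv_mul e3 (hd hFjl),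
    pderiv_mul (hd (hFj j)) (hd (hFj l)), pderiv_comp_eqOn hU hI hk2 hF1 hm i hy,
    pderiv_comp_eqOn hU hI (hk1.of_le one_le_two) hF1 hm i hy, pderiv_comm hU hF2 hy i l]
  ring

theorem pderiv_pderiv_mul_eqOn (hU : IsOpen U) (hF : ContDiffOn ℝ 2 F U) (hG : ContDiffOn ℝ 2 G U)
    (i j : Fin d) :
    EqOn (pderiv i (pderiv j fun y => F y * G y))
      (fun y => F y * pderiv i (pderiv j G) y + pderiv i F y * pderiv j G y +
        pderiv j F y * pderiv i G y + pderiv i (pderiv j F) y * G y) U := fun y hy => by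
  have hd := fun {H : (Fin d → ℝ) → ℝ} (hH : ContDiffOn ℝ 1 H U) {z} (hz : z ∈ U) =>
    (hH.differentiableOn one_ne_zero).differentiableAt (hU.mem_nhds hz)
  have hF1 : ContDiffOn ℝ 1 F U := hF.of_le one_le_two
  have hG1 : ContDiffOn ℝ 1 G U := hG.of_le one_le_two
  have hFj : ContDiffOn ℝ 1 (pderiv j F) U := contDiffOn_pderiv hU hF (by norm_num) j
  have hGj : ContDiffOn ℝ 1 (pderiv j G) U := contDiffOn_pderiv hU hG (by norm_num) j
  have h1 : EqOn (pderiv j fun y => F y * G y)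
      (fun y => F y * pderiv j G y + pderiv j F y * G y) U := fun z hz =>
    pderiv_mul (hd hF1 hz) (hd hG1 hz) j
  rw [pderiv_eqOn hU h1 i hy, pderiv_add ((hd hF1 hy).fun_mul (hd hGj hy))
    ((hd hFj hy).fun_mul (hd hG1 hy)), pderiv_mul (hd hF1 hy) (hd hGj hy),
    pderiv_mul (hd hFj hy) (hd hG1 hy)]
  ring

theorem pderiv_pderiv_pderiv_mul_eqOn (hU : IsOpen U) (hF : ContDiffOn ℝ 3 F U)
    (hG : ContDiffOn ℝ 3 G U) (i j l : Fin d) :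
    EqOn (pderiv i (pderiv j (pderiv l fun y => F y * G y)))
      (fun y => F y * pderiv i (pderiv j (pderiv l G)) y +
        pderiv i F y * pderiv j (pderiv l G) y + pderiv j F y * pderiv i (pderiv l G) y +
        pderiv l F y * pderiv i (pderiv j G) y + pderiv i (pderiv j F) y * pderiv l G y +
        pderiv i (pderiv l F) y * pderiv j G y + pderiv j (pderiv l F) y * pderiv i G y +
        pderiv i (pderiv j (pderiv l F)) y * G y) U := fun y hy => by
  have hd := fun {H : (Fin d → ℝ) → ℝ} (hH : ContDiffOn ℝ 2 H U) {z} (hz : z ∈ U) =>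
    (hH.differentiableOn two_ne_zero).differentiableAt (hU.mem_nhds hz)
  have hd' := fun {H : (Fin d → ℝ) → ℝ} (hH : ContDiffOn ℝ 2 H U) (j : Fin d) =>
    ((contDiffOn_pderiv hU hH (m := 1) (by norm_num) j).differentiableOn
      one_ne_zero).differentiableAt (hU.mem_nhds hy)
  have hF2 : ContDiffOn ℝ 2 F U := hF.of_le (by norm_num)
  have hG2 : ContDiffOn ℝ 2 G U := hG.of_le (by norm_num)
  have hFl : ContDiffOn ℝ 2 (pderiv l F) U := contDiffOn_pderiv hU hF (by norm_num) l
  have hGl : ContDiffOn ℝ 2 (pderiv l G) U := contDiffOn_pderiv hU hG (by norm_num) l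
  have h1 : EqOn (pderiv l fun y => F y * G y)
      (fun y => F y * pderiv l G y + pderiv l F y * G y) U := fun z hz =>
    pderiv_mul (hd hF2 hz) (hd hG2 hz) l
  have h2 : EqOn (pderiv j fun y => F y * pderiv l G y + pderiv l F y * G y)
      (fun y => pderiv j (fun y => F y * pderiv l G y) y +
        pderiv j (fun y => pderiv l F y * G y) y) U := fun z hz =>
    pderiv_add ((hd hF2 hz).fun_mul (hd hGl hz)) ((hd hFl hz).fun_mul (hd hG2 hz)) j
  rw [pderiv_eqOn hU (pderiv_eqOn hU h1 j) i hy, pderiv_eqOn hU h2 i hy,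
    pderiv_add (hd' (hF2.mul hGl) j) (hd' (hFl.mul hG2) j),
    pderiv_pderiv_mul_eqOn hU hF2 hGl i j hy, pderiv_pderiv_mul_eqOn hU hFl hG2 i j hy]
  ring

end Calculus

/-! ### Functions of local `L^q`-type -/

section LType

open Set

theorem isOpen_cube {d : ℕ} {I : Set ℝ} (hI : IsOpen I) : IsOpen (cube d I) := by
  have : cube d I = Set.pi univ fun _ => I := by ext; simp [cube]
  rw [this]
  exact isOpen_set_pi finite_univ fun _ _ => hI

theorem diag_mem_cube {d : ℕ} {I : Set ℝ} {x : ℝ} (hx : x ∈ I) : diag d x ∈ cube d I := fun _ => hx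

theorem contDiffOn_pd {d : ℕ} {T : Type*} {I : Set ℝ} {φ : (Fin d → ℝ) → T → ℝ} (hI : IsOpen I)
    {m n : WithTop ℕ∞}
    (hc : ∀ t, ContDiffOn ℝ n (fun x => φ x t) (cube d I)) (hmn : m + 1 ≤ n) (i : Fin d) (t : T) :
    ContDiffOn ℝ m (fun x => pd i φ x t) (cube d I) :=
  contDiffOn_pderiv (isOpen_cube hI) (hc t) hmn i

variable {d : ℕ} {T : Type*} [MeasurableSpace T] {μ : Measure T} {I : Set ℝ}
  {φ ψ : (Fin d → ℝ) → T → ℝ} {p : Fin d → ℝ}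

theorem IsLType.congr {q : ENNReal} (h : IsLType μ q I φ p) (hp : p ∈ cube d I)
    (e : ∀ x ∈ cube d I, ∀ t, ψ x t = φ x t) : IsLType μ q I ψ p := by
  obtain ⟨hm, δ, hδ, a, ha, hL, hb⟩ := h
  have : ψ p = φ p := funext (e p hp)
  exact ⟨this ▸ hm, δ, hδ, a, ha, hL, fun t x hx hxδ => (e x hx t) ▸ hb t x hx hxδ⟩

theorem IsLType.mono [IsFiniteMeasure μ] {q r : ENNReal} (h : IsLType μ q I φ p) (hrq : r ≤ q) :
    IsLType μ r I φ p := by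
  obtain ⟨hm, δ, hδ, a, ha, hL, hb⟩ := h
  exact ⟨hm, δ, hδ, a, ha, hL.mono_exponent hrq, hb⟩

theorem IsLType.add {q : ENNReal} (h : IsLType μ q I φ p) (h' : IsLType μ q I ψ p) :
    IsLType μ q I (fun x t => φ x t + ψ x t) p := by
  obtain ⟨hm, δ, hδ, a, ha, hL, hb⟩ := h
  obtain ⟨hm', δ', hδ', a', ha', hL', hb'⟩ := h'
  refine ⟨hm.add hm', min δ δ', lt_min hδ hδ', a + a', ha.add ha', hL.add hL', ?_⟩
  intro t x hx hxδ
  exact (abs_add_le _ _).trans (add_le_add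
    (hb t x hx (Metric.closedBall_subset_closedBall (min_le_left _ _) hxδ))
    (hb' t x hx (Metric.closedBall_subset_closedBall (min_le_right _ _) hxδ)))

/-- Hölder's inequality for functions of local `L^q`-type. -/
theorem IsLType.mul {q r s : ENNReal} [ENNReal.HolderTriple q r s] (h : IsLType μ q I φ p)
    (h' : IsLType μ r I ψ p) : IsLType μ s I (fun x t => φ x t * ψ x t) p := by
  obtain ⟨hm, δ, hδ, a, ha, hL, hb⟩ := h
  obtain ⟨hm', δ', hδ', a', ha', hL', hb'⟩ := h'
  refine ⟨hm.mul hm', min δ δ', lt_min hδ hδ', fun t => a t * a' t, ha.mul ha',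
    hL'.mul' hL, ?_⟩
  intro t x hx hxδ
  rw [abs_mul]
  have h1 := hb t x hx (Metric.closedBall_subset_closedBall (min_le_left _ _) hxδ)
  exact mul_le_mul h1 (hb' t x hx (Metric.closedBall_subset_closedBall (min_le_right _ _) hxδ))
    (abs_nonneg _) ((abs_nonneg _).trans h1)

theorem IsLType.memLp {q : ENNReal} (h : IsLType μ q I φ p) (hp : p ∈ cube d I) :
    MemLp (φ p) q μ := by
  obtain ⟨hm, δ, hδ, a, ha, hL, hb⟩ := h
  exact hL.mono hm.aestronglyMeasurable (Filter.Eventually.of_forall fun t =>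
    (hb t p hp (Metric.mem_closedBall_self hδ.le)).trans (le_abs_self _))

theorem IsLType.integrable (h : IsLType μ 1 I φ p) (hp : p ∈ cube d I) : Integrable (φ p) μ :=
  memLp_one_iff_integrable.1 (h.memLp hp)

/-- A continuous function of a measurable family of means is locally bounded, because the values of
the means near `p` stay in a compact subinterval of `I`. -/
theorem IsMeasurableFamily.isLType_comp [IsFiniteMeasure μ] (hd : 1 ≤ d) (hI : IsOpen I)
    (hI' : I.OrdConnected) {m : (Fin d → ℝ) → T → ℝ} (hm : IsMeasurableFamily I m) {k : ℝ → ℝ}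
    (hk : ContinuousOn k I) (hp : p ∈ cube d I) : IsLType μ ⊤ I (fun x t => k (m x t)) p := by
  have : Nonempty (Fin d) := ⟨⟨0, hd⟩⟩
  constructor
  · have hk' : Measurable (I.domRestrict k) := hk.domRestrict.measurable
    exact hk'.comp ((hm.2 p hp).subtype_mk (h := fun t => (hm.1 t p hp).1))
  obtain ⟨δ, hδ, hball⟩ := Metric.nhds_basis_closedBall.mem_iff.1 ((isOpen_cube hI).mem_nhds hp)
  obtain ⟨i₀, hi₀⟩ := exists_eq_ciInf_of_finite (f := p)
  obtain ⟨i₁, hi₁⟩ := exists_eq_ciSup_of_finite (f := p)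
  have hlo : p i₀ - δ ∈ I :=
    hball (show (fun i => p i - δ) ∈ _ by
      rw [Metric.mem_closedBall, dist_pi_le_iff hδ.le]; intro i; simp [abs_of_pos hδ]) i₀
  have hhi : p i₁ + δ ∈ I :=
    hball (show (fun i => p i + δ) ∈ _ by
      rw [Metric.mem_closedBall, dist_pi_le_iff hδ.le]; intro i; simp [abs_of_pos hδ]) i₁
  obtain ⟨C, hC⟩ := (isCompact_Icc (a := p i₀ - δ) (b := p i₁ + δ)).exists_bound_of_continuousOn
    (hk.mono (hI'.out hlo hhi))
  refine ⟨δ, hδ, fun _ => C, measurable_const, memLp_const C, fun t x hx hxδ => hC _ ?_⟩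
  rw [Metric.mem_closedBall, dist_pi_le_iff hδ.le] at hxδ
  obtain ⟨-, h1, h2⟩ := hm.1 t x hx
  refine ⟨le_trans (le_ciInf fun i => ?_) h1, h2.trans (ciSup_le fun i => ?_)⟩
  · have h3 := (abs_le.1 (hxδ i)).1
    have h4 : p i₀ ≤ p i := hi₀ ▸ ciInf_le (finite_range p).bddBelow i
    linarith
  · have h3 := (abs_le.1 (hxδ i)).2
    have h4 : p i ≤ p i₁ := hi₁ ▸ le_ciSup (finite_range p).bddAbove i
    linarith

theorem continuousOn_avg (hI : IsOpen I) (hc : ∀ t, ContinuousOn (fun x => φ x t) (cube d I))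
    (hφ : ∀ p ∈ cube d I, IsLType μ 1 I φ p) : ContinuousOn (avg μ φ) (cube d I) := by
  intro p hp
  obtain ⟨hm, δ, hδ, a, ha, hL, hb⟩ := hφ p hp
  have hU := (isOpen_cube hI).mem_nhds hp
  refine ContinuousAt.continuousWithinAt (continuousAt_of_dominated (bound := a) ?_ ?_
    (memLp_one_iff_integrable.1 hL) ?_)
  · filter_upwards [hU] with x hx using (hφ x hx).1.aestronglyMeasurable
  · filter_upwards [hU, Metric.closedBall_mem_nhds p hδ] with x hx hxδ
    exact Filter.Eventually.of_forall fun t => hb t x hx hxδ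
  · exact Filter.Eventually.of_forall fun t => (hc t).continuousAt hU

/-- Differentiation under the integral sign. -/
theorem hasFDerivAt_avg (hI : IsOpen I) (hc : ∀ t, ContDiffOn ℝ 1 (fun x => φ x t) (cube d I))
    (hφ : ∀ p ∈ cube d I, IsLType μ 1 I φ p)
    (hφ' : ∀ i, ∀ p ∈ cube d I, IsLType μ 1 I (pd i φ) p) (hp : p ∈ cube d I) :
    HasFDerivAt (avg μ φ)
      (∑ i, avg μ (pd i φ) p • (ContinuousLinearMap.proj i : (Fin d → ℝ) →L[ℝ] ℝ)) p := by
  have hU := (isOpen_cube hI).mem_nhds hp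
  choose hm δ hδ a ha hL hb using fun i => hφ' i p hp
  have hint : ∀ i, Integrable (pd i φ p) μ := fun i => (hφ' i p hp).integrable hp
  have hs : cube d I ∩ ⋂ i, Metric.closedBall p (δ i) ∈ nhds p :=
    Filter.inter_mem hU (Filter.iInter_mem.2 fun i => Metric.closedBall_mem_nhds p (hδ i))
  have hint' : ∀ i, Integrable
      (fun t => pd i φ p t • (ContinuousLinearMap.proj i : (Fin d → ℝ) →L[ℝ] ℝ)) μ :=
    fun i => (hint i).smul_const _
  have hsum : ∫ t, ∑ i, pd i φ p t • (ContinuousLinearMap.proj i : (Fin d → ℝ) →L[ℝ] ℝ) ∂μ =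
      ∑ i, avg μ (pd i φ) p • (ContinuousLinearMap.proj i : (Fin d → ℝ) →L[ℝ] ℝ) := by
    rw [integral_finsetSum _ fun i _ => hint' i]
    exact Finset.sum_congr rfl fun i _ => integral_smul_const _ _
  rw [← hsum]
  have hmeas : ∀ᶠ x in nhds p, AEStronglyMeasurable (φ x) μ := by
    filter_upwards [hU] with x hx using (hφ x hx).1.aestronglyMeasurable
  have hbound : ∀ᵐ t ∂μ, ∀ x ∈ cube d I ∩ ⋂ i, Metric.closedBall p (δ i),
      ‖∑ i, pd i φ x t • (ContinuousLinearMap.proj i : (Fin d → ℝ) →L[ℝ] ℝ)‖ ≤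
        ∑ i, a i t * ‖(ContinuousLinearMap.proj i : (Fin d → ℝ) →L[ℝ] ℝ)‖ := by
    refine Filter.Eventually.of_forall fun t x hx =>
      (norm_sum_le _ _).trans (Finset.sum_le_sum fun i _ => ?_)
    rw [norm_smul]
    exact mul_le_mul_of_nonneg_right (hb i t x hx.1 (mem_iInter.1 hx.2 i)) (norm_nonneg _)
  have hdiff : ∀ᵐ t ∂μ, ∀ x ∈ cube d I ∩ ⋂ i, Metric.closedBall p (δ i),
      HasFDerivAt (fun x => φ x t)
        (∑ i, pd i φ x t • (ContinuousLinearMap.proj i : (Fin d → ℝ) →L[ℝ] ℝ)) x :=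
    Filter.Eventually.of_forall fun t x hx => hasFDerivAt_sum_pderiv
      (((hc t).differentiableOn one_ne_zero).differentiableAt ((isOpen_cube hI).mem_nhds hx.1))
  have hbint : Integrable
      (fun t => ∑ i, a i t * ‖(ContinuousLinearMap.proj i : (Fin d → ℝ) →L[ℝ] ℝ)‖) μ :=
    integrable_finsetSum _ fun i _ => (memLp_one_iff_integrable.1 (hL i)).mul_const _
  have hmeas' : AEStronglyMeasurable
      (fun t => ∑ i, pd i φ p t • (ContinuousLinearMap.proj i : (Fin d → ℝ) →L[ℝ] ℝ)) μ :=
    Finset.aestronglyMeasurable_fun_sum _ fun i _ => (hint' i).aestronglyMeasurable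
  exact hasFDerivAt_integral_of_dominated_of_fderiv_le
    (F' := fun x t => ∑ i, pd i φ x t • (ContinuousLinearMap.proj i : (Fin d → ℝ) →L[ℝ] ℝ))
    hs hmeas ((hφ p hp).integrable hp) hmeas' hbound hbint hdiff

theorem pderiv_avg_eqOn (hI : IsOpen I) (hc : ∀ t, ContDiffOn ℝ 1 (fun x => φ x t) (cube d I))
    (hφ : ∀ p ∈ cube d I, IsLType μ 1 I φ p)
    (hφ' : ∀ i, ∀ p ∈ cube d I, IsLType μ 1 I (pd i φ) p) (i : Fin d) :
    EqOn (pderiv i (avg μ φ)) (avg μ (pd i φ)) (cube d I) := fun p hp => by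
  have h := hasFDerivAt_avg hI hc hφ hφ' hp
  rw [pderiv_eq_fderiv h.differentiableAt, h.fderiv]
  simp [Pi.single_apply]

/-- All partial derivatives of `φ` in the spatial variables up to order `n` are of `L¹`-type at every
point of `I^d`. -/
def HasL1Jet (μ : Measure T) (I : Set ℝ) : ℕ → ((Fin d → ℝ) → T → ℝ) → Prop
  | 0, φ => ∀ p ∈ cube d I, IsLType μ 1 I φ p
  | n + 1, φ => (∀ p ∈ cube d I, IsLType μ 1 I φ p) ∧ ∀ i, HasL1Jet μ I n (pd i φ)

theorem HasL1Jet.isLType {n : ℕ} (h : HasL1Jet μ I n φ) : ∀ p ∈ cube d I, IsLType μ 1 I φ p := by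
  cases n with
  | zero => exact h
  | succ n => exact h.1

theorem HasL1Jet.contDiffOn_avg (hI : IsOpen I) {n : ℕ} (h : HasL1Jet μ I n φ)
    (hc : ∀ t, ContDiffOn ℝ n (fun x => φ x t) (cube d I)) :
    ContDiffOn ℝ n (avg μ φ) (cube d I) := by
  induction n generalizing φ with
  | zero =>
    rw [Nat.cast_zero, contDiffOn_zero]
    exact continuousOn_avg hI (fun t => (hc t).continuousOn) h
  | succ n ih =>
    rw [Nat.cast_succ]
    refine contDiffOn_succ_of_hasFDerivAt_sum (isOpen_cube hI)
      (fun x hx => hasFDerivAt_avg hI (fun t => (hc t).of_le ?_) h.1 (fun i => (h.2 i).isLType) hx)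
      fun i => ih (h.2 i) (contDiffOn_pd hI hc (by simp) i)
    simp

theorem HasL1Jet.pderiv_avg (hI : IsOpen I) (h : HasL1Jet μ I 1 φ)
    (hc : ∀ t, ContDiffOn ℝ 1 (fun x => φ x t) (cube d I)) (i : Fin d) :
    EqOn (pderiv i (avg μ φ)) (avg μ (pd i φ)) (cube d I) :=
  pderiv_avg_eqOn hI hc h.1 (fun i => h.2 i) i

theorem HasL1Jet.pderiv_pderiv_avg (hI : IsOpen I) (h : HasL1Jet μ I 2 φ)
    (hc : ∀ t, ContDiffOn ℝ 2 (fun x => φ x t) (cube d I)) (i j : Fin d) :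
    EqOn (pderiv i (pderiv j (avg μ φ))) (avg μ (pd i (pd j φ))) (cube d I) := by
  have h1 := pderiv_avg_eqOn hI (fun t => (hc t).of_le one_le_two) h.1
    (fun i => (h.2 i).isLType) j
  exact (pderiv_eqOn (isOpen_cube hI) h1 i).trans
    ((h.2 j).pderiv_avg hI (contDiffOn_pd hI hc (by norm_num) j) i)

theorem HasL1Jet.pderiv_pderiv_pderiv_avg (hI : IsOpen I) (h : HasL1Jet μ I 3 φ)
    (hc : ∀ t, ContDiffOn ℝ 3 (fun x => φ x t) (cube d I)) (i j l : Fin d) :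
    EqOn (pderiv i (pderiv j (pderiv l (avg μ φ)))) (avg μ (pd i (pd j (pd l φ)))) (cube d I) := by
  have h1 := pderiv_avg_eqOn hI (fun t => (hc t).of_le (by norm_num)) h.1
    (fun i => (h.2 i).isLType) l
  have hU := isOpen_cube (d := d) hI
  exact (pderiv_eqOn hU (pderiv_eqOn hU h1 j) i).trans
    ((h.2 l).pderiv_pderiv_avg hI (contDiffOn_pd hI hc (by norm_num) l) i j)

end LType

/-! ### Composition of a generating function with a family of means -/

section Composition

open Set

variable {d : ℕ} {T : Type*} [MeasurableSpace T] {μ : Measure T} {I : Set ℝ}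
  {m : (Fin d → ℝ) → T → ℝ} {k : ℝ → ℝ} {x : ℝ}

theorem IsMeasurableFamily.mapsTo (hm : IsMeasurableFamily I m) (t : T) :
    MapsTo (fun y => m y t) (cube d I) I := fun y hy => (hm.1 t y hy).1

theorem IsMeasurableFamily.apply_diag (hd : 1 ≤ d) (hm : IsMeasurableFamily I m) (hx : x ∈ I)
    (t : T) : m (diag d x) t = x := by
  have : Nonempty (Fin d) := ⟨⟨0, hd⟩⟩
  obtain ⟨-, h1, h2⟩ := hm.1 t _ (diag_mem_cube hx)
  simp only [diag, ciInf_const, ciSup_const] at h1 h2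
  exact le_antisymm h2 h1

theorem IsMeasurableFamily.contDiffOn_comp (hm : IsMeasurableFamily I m) {n : WithTop ℕ∞}
    (hk : ContDiffOn ℝ n k I) (hc : ∀ t, ContDiffOn ℝ n (fun y => m y t) (cube d I)) (t : T) :
    ContDiffOn ℝ n (fun y => k (m y t)) (cube d I) :=
  hk.comp (hc t) (hm.mapsTo t)

instance : ENNReal.HolderTriple 3 3 (3 / 2) where
  inv_add_inv_eq_inv := by
    rw [ENNReal.inv_div (by simp) (by simp), ENNReal.div_eq_inv_mul, mul_two]

instance : ENNReal.HolderTriple (3 / 2) 3 1 where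
  inv_add_inv_eq_inv := by
    rw [ENNReal.inv_div (by simp) (by simp), ENNReal.div_eq_inv_mul, mul_two, inv_one,
      ← ENNReal.inv_three_add_inv_three]

variable [IsProbabilityMeasure μ]

theorem FamilyClass1.hasL1Jet_comp (hd : 1 ≤ d) (hI : IsOpen I) (hI' : I.OrdConnected)
    (hm : FamilyClass1 μ I m) (hk : ContDiffOn ℝ 1 k I) :
    HasL1Jet μ I 1 (fun y t => k (m y t)) := by
  have hk1 : ContinuousOn (deriv k) I := hk.continuousOn_deriv_of_isOpen hI le_rfl
  refine ⟨fun p hp => (hm.family.isLType_comp hd hI hI' hk.continuousOn hp).mono le_top,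
    fun i p hp => ?_⟩
  exact ((hm.family.isLType_comp hd hI hI' hk1 hp).mul (hm.type_one p hp i)).congr hp
    fun y hy t => pderiv_comp_eqOn (isOpen_cube hI) hI hk (hm.contDiff_one t)
      (hm.family.mapsTo t) i hy

/-- The second derivatives of `k ∘ m` are `k''(m) ∂ᵢm ∂ⱼm + k'(m) ∂ᵢ∂ⱼm`: the first term is of `L¹`-type
by the Cauchy–Schwarz inequality. -/
theorem FamilyClass2.hasL1Jet_comp (hd : 1 ≤ d) (hI : IsOpen I) (hI' : I.OrdConnected)
    (hm : FamilyClass2 μ I m) (hk : ContDiffOn ℝ 2 k I) :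
    HasL1Jet μ I 2 (fun y t => k (m y t)) := by
  have hk1 : ContDiffOn ℝ 1 (deriv k) I := hk.deriv_of_isOpen hI (by norm_num)
  have hk2 : ContinuousOn (deriv (deriv k)) I := hk1.continuousOn_deriv_of_isOpen hI le_rfl
  have h1 := hm.toFamilyClass1.hasL1Jet_comp hd hI hI' (hk.of_le one_le_two)
  refine ⟨h1.1, fun j => ⟨h1.2 j, fun i p hp => ?_⟩⟩
  exact (((hm.family.isLType_comp hd hI hI' hk2 hp).mul
      ((hm.type_two p hp i i).1.mul (hm.type_two p hp j j).1 (s := 1))).add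
    ((hm.family.isLType_comp hd hI hI' hk1.continuousOn hp).mul (hm.type_two p hp i j).2)).congr hp
    fun y hy t => pderiv_pderiv_comp_eqOn (isOpen_cube hI) hI hk (hm.contDiff_two t)
      (hm.family.mapsTo t) i j hy

/-- In the third derivatives of `k ∘ m`, the exponents `(3, 3, 3)` for `∂m ∂m ∂m` and `(3/2, 3)` for
`∂∂m ∂m` add up to those of `L¹` in Hölder's inequality. -/
theorem FamilyClass3.hasL1Jet_comp (hd : 1 ≤ d) (hI : IsOpen I) (hI' : I.OrdConnected)
    (hm : FamilyClass3 μ I m) (hk : ContDiffOn ℝ 3 k I) :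
    HasL1Jet μ I 3 (fun y t => k (m y t)) := by
  have hk1 : ContDiffOn ℝ 2 (deriv k) I := hk.deriv_of_isOpen hI (by norm_num)
  have hk2 : ContDiffOn ℝ 1 (deriv (deriv k)) I := hk1.deriv_of_isOpen hI (by norm_num)
  have hk3 : ContinuousOn (deriv (deriv (deriv k))) I := hk2.continuousOn_deriv_of_isOpen hI le_rfl
  have h2 := hm.toFamilyClass2.hasL1Jet_comp hd hI hI' (hk.of_le (by norm_num))
  refine ⟨h2.1, fun l => ⟨(h2.2 l).1, fun j => ⟨(h2.2 l).2 j, fun i p hp => ?_⟩⟩⟩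
  have t1 := fun i => (hm.type_three p hp i i i).1
  have t2 := fun i j => (hm.type_three p hp i j i).2.1
  have t3 := fun i j l => (t2 i j).mul (t1 l) (s := 1)
  exact ((((hm.family.isLType_comp hd hI hI' hk3 hp).mul
      (((t1 i).mul (t1 j) (s := 3 / 2)).mul (t1 l) (s := 1))).add
    ((hm.family.isLType_comp hd hI hI' hk2.continuousOn hp).mul
      (((t3 i j l).add (t3 j l i)).add (t3 l i j)))).add
    ((hm.family.isLType_comp hd hI hI' hk1.continuousOn hp).mul
      (hm.type_three p hp i j l).2.2)).congr hp
    fun y hy t => pderiv_pderiv_pderiv_comp_eqOn (isOpen_cube hI) hI hk (hm.contDiff_three t)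
      (hm.family.mapsTo t) i j l hy

theorem avg_comp_diag (hd : 1 ≤ d) (hm : IsMeasurableFamily I m) (hx : x ∈ I) :
    avg μ (fun y t => k (m y t)) (diag d x) = k x := by
  simp [avg, hm.apply_diag hd hx]

theorem FamilyClass1.pderiv_avg_comp_diag (hd : 1 ≤ d) (hI : IsOpen I) (hI' : I.OrdConnected)
    (hm : FamilyClass1 μ I m) (hk : ContDiffOn ℝ 1 k I) (hx : x ∈ I) (i : Fin d) :
    pderiv i (avg μ fun y t => k (m y t)) (diag d x) =
      deriv k x * avg μ (pd i m) (diag d x) := by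
  have hp := diag_mem_cube (d := d) hx
  rw [(hm.hasL1Jet_comp hd hI hI' hk).pderiv_avg hI
    (hm.family.contDiffOn_comp hk hm.contDiff_one) i hp, avg, avg, ← integral_const_mul]
  refine integral_congr_ae (Filter.Eventually.of_forall fun t => ?_)
  refine (pderiv_comp_eqOn (isOpen_cube hI) hI hk (hm.contDiff_one t)
      (hm.family.mapsTo t) i hp).trans ?_
  simp only [hm.family.apply_diag hd hx]
  rfl

theorem FamilyClass2.pderiv_pderiv_avg_comp_diag (hd : 1 ≤ d) (hI : IsOpen I)
    (hI' : I.OrdConnected) (hm : FamilyClass2 μ I m) (hk : ContDiffOn ℝ 2 k I) (hx : x ∈ I)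
    (i j : Fin d) :
    pderiv i (pderiv j (avg μ fun y t => k (m y t))) (diag d x) =
      deriv (deriv k) x * avg μ (fun y t => pd i m y t * pd j m y t) (diag d x) +
        deriv k x * avg μ (pd i (pd j m)) (diag d x) := by
  have hp := diag_mem_cube (d := d) hx
  have i1 := ((hm.type_two _ hp i i).1.mul (hm.type_two _ hp j j).1 (s := 1)).integrable hp
  have i2 := (hm.type_two _ hp i j).2.integrable hp
  rw [(hm.hasL1Jet_comp hd hI hI' hk).pderiv_pderiv_avg hI
    (hm.family.contDiffOn_comp hk hm.contDiff_two) i j hp, avg, avg, avg, ← integral_const_mul,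
    ← integral_const_mul, ← integral_add (i1.const_mul _) (i2.const_mul _)]
  refine integral_congr_ae (Filter.Eventually.of_forall fun t => ?_)
  refine (pderiv_pderiv_comp_eqOn (isOpen_cube hI) hI hk (hm.contDiff_two t)
      (hm.family.mapsTo t) i j hp).trans ?_
  simp only [hm.family.apply_diag hd hx]
  rfl

theorem FamilyClass3.pderiv_pderiv_pderiv_avg_comp_diag (hd : 1 ≤ d) (hI : IsOpen I)
    (hI' : I.OrdConnected) (hm : FamilyClass3 μ I m) (hk : ContDiffOn ℝ 3 k I) (hx : x ∈ I)
    (i j l : Fin d) :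
    pderiv i (pderiv j (pderiv l (avg μ fun y t => k (m y t)))) (diag d x) =
      deriv (deriv (deriv k)) x *
          avg μ (fun y t => pd i m y t * pd j m y t * pd l m y t) (diag d x) +
        deriv (deriv k) x *
          (avg μ (fun y t => pd i (pd j m) y t * pd l m y t) (diag d x) +
            avg μ (fun y t => pd j (pd l m) y t * pd i m y t) (diag d x) +
            avg μ (fun y t => pd l (pd i m) y t * pd j m y t) (diag d x)) +
        deriv k x * avg μ (pd i (pd j (pd l m))) (diag d x) := by
  have hp := diag_mem_cube (d := d) hx
  have t1 := fun i => (hm.type_three _ hp i i i).1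
  have t2 := fun i j => (hm.type_three _ hp i j i).2.1
  have i1 := (((t1 i).mul (t1 j) (s := 3 / 2)).mul (t1 l) (s := 1)).integrable hp
  have i2 := fun i j l => ((t2 i j).mul (t1 l) (s := 1)).integrable hp
  have i3 := (hm.type_three _ hp i j l).2.2.integrable hp
  rw [(hm.hasL1Jet_comp hd hI hI' hk).pderiv_pderiv_pderiv_avg hI
    (hm.family.contDiffOn_comp hk hm.contDiff_three) i j l hp]
  simp only [avg]
  have i4 : Integrable (fun t => pd i (pd j m) (diag d x) t * pd l m (diag d x) t +
      pd j (pd l m) (diag d x) t * pd i m (diag d x) t) μ := (i2 i j l).add (i2 j l i)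
  have i5 : Integrable (fun t => pd i (pd j m) (diag d x) t * pd l m (diag d x) t +
      pd j (pd l m) (diag d x) t * pd i m (diag d x) t +
      pd l (pd i m) (diag d x) t * pd j m (diag d x) t) μ := i4.add (i2 l i j)
  have i6 : Integrable (fun t => deriv (deriv (deriv k)) x *
      (pd i m (diag d x) t * pd j m (diag d x) t * pd l m (diag d x) t) + deriv (deriv k) x *
      (pd i (pd j m) (diag d x) t * pd l m (diag d x) t +
      pd j (pd l m) (diag d x) t * pd i m (diag d x) t +
      pd l (pd i m) (diag d x) t * pd j m (diag d x) t)) μ := (i1.const_mul _).add (i5.const_mul _)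
  rw [← integral_add (i2 i j l) (i2 j l i), ← integral_add i4 (i2 l i j),
    ← integral_const_mul, ← integral_const_mul, ← integral_const_mul,
    ← integral_add (i1.const_mul _) (i5.const_mul _),
    ← integral_add i6 (i3.const_mul _)]
  refine integral_congr_ae (Filter.Eventually.of_forall fun t => ?_)
  refine (pderiv_pderiv_pderiv_comp_eqOn (isOpen_cube hI) hI hk (hm.contDiff_three t)
      (hm.family.mapsTo t) i j l hp).trans ?_
  simp only [hm.family.apply_diag hd hx]
  rfl

end Composition

/-! ### Existence, uniqueness and smoothness of the mean -/

section Mean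

open Set

variable {d : ℕ} {I : Set ℝ} {f g : ℝ → ℝ}

/-- The determinant of a Chebyshev system has constant sign below the diagonal of `I × I`, since this
triangle is connected. -/
theorem IsChebyshev.exists_sign (hI' : I.OrdConnected) (hC : IsChebyshev I f g) :
    ∃ σ : ℝ, ∀ u ∈ I, ∀ v ∈ I, v < u → 0 < σ * chebDet f g u v := by
  obtain ⟨hf, hg, hD⟩ := hC
  set S : Set (ℝ × ℝ) := (I ×ˢ I) ∩ {q | q.2 < q.1} with hS
  have hconv : Convex ℝ S := (hI'.convex.prod hI'.convex).inter <| by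
    have : {q : ℝ × ℝ | q.2 < q.1} = {q | (LinearMap.snd ℝ ℝ ℝ - LinearMap.fst ℝ ℝ ℝ) q < 0} := by
      ext; simp
    rw [this]
    exact convex_halfSpace_lt (LinearMap.isLinear _) 0
  have hcont : ContinuousOn (fun q : ℝ × ℝ => chebDet f g q.1 q.2) S := by
    have h1 : MapsTo (Prod.fst : ℝ × ℝ → ℝ) S I := fun q hq => hq.1.1
    have h2 : MapsTo (Prod.snd : ℝ × ℝ → ℝ) S I := fun q hq => hq.1.2
    exact ((hf.comp continuousOn_fst h1).mul (hg.comp continuousOn_snd h2)).sub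
      ((hf.comp continuousOn_snd h2).mul (hg.comp continuousOn_fst h1))
  by_cases hne : S.Nonempty
  · obtain ⟨q₀, hq₀⟩ := hne
    refine ⟨chebDet f g q₀.1 q₀.2, fun u hu v hv huv => ?_⟩
    by_contra! hle
    have hpos : 0 ≤ chebDet f g q₀.1 q₀.2 * chebDet f g q₀.1 q₀.2 := mul_self_nonneg _
    obtain ⟨q, hq, hq0⟩ := hconv.isPreconnected.intermediate_value
      (show (u, v) ∈ S from ⟨⟨hu, hv⟩, huv⟩) hq₀
      ((continuousOn_const (c := chebDet f g q₀.1 q₀.2)).mul hcont) ⟨hle, hpos⟩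
    rcases mul_eq_zero.1 hq0 with h | h
    · exact hD _ hq₀.1.1 _ hq₀.1.2 (ne_of_gt hq₀.2) h
    · exact hD _ hq.1.1 _ hq.1.2 (ne_of_gt hq.2) h
  · exact ⟨0, fun u hu v hv huv => (hne ⟨(u, v), ⟨hu, hv⟩, huv⟩).elim⟩

theorem chebDet_swap (x y : ℝ) : chebDet f g x y = -chebDet f g y x := by
  simp only [chebDet]; ring

variable {T : Type*} [MeasurableSpace T] {μ : Measure T} [IsProbabilityMeasure μ]
  {m : (Fin d → ℝ) → T → ℝ} {x : Fin d → ℝ}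

theorem IsMeasurableFamily.integrable_comp (hd : 1 ≤ d) (hI : IsOpen I) (hI' : I.OrdConnected)
    (hm : IsMeasurableFamily I m) {k : ℝ → ℝ} (hk : ContinuousOn k I) (hx : x ∈ cube d I) :
    Integrable (fun t => k (m x t)) μ :=
  ((hm.isLType_comp hd hI hI' hk hx).mono le_top).integrable hx

theorem integrable_chebDet (hd : 1 ≤ d) (hI : IsOpen I) (hI' : I.OrdConnected)
    (hC : IsChebyshev I f g) (hm : IsMeasurableFamily I m) (hx : x ∈ cube d I) (y : ℝ) :
    Integrable (fun t => chebDet f g (m x t) y) μ :=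
  ((hm.integrable_comp hd hI hI' hC.1 hx).mul_const _).sub
    ((hm.integrable_comp hd hI hI' hC.2.1 hx).const_mul _)

theorem integral_chebDet (hd : 1 ≤ d) (hI : IsOpen I) (hI' : I.OrdConnected)
    (hC : IsChebyshev I f g) (hm : IsMeasurableFamily I m) (hx : x ∈ cube d I) (y : ℝ) :
    ∫ t, chebDet f g (m x t) y ∂μ =
      avg μ (fun y t => f (m y t)) x * g y - f y * avg μ (fun y t => g (m y t)) x := by
  simp only [chebDet]
  rw [integral_sub ((hm.integrable_comp hd hI hI' hC.1 hx).mul_const _)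
    ((hm.integrable_comp hd hI hI' hC.2.1 hx).const_mul _), integral_mul_const,
    integral_const_mul]
  rfl

/-- The averages of `f ∘ m` and `g ∘ m` do not vanish simultaneously: a point `p ∈ I` to the left of
all the values `m x t` gives a combination `D(·, p)` of `f` and `g` with positive average. -/
theorem avg_ne_zero (hd : 1 ≤ d) (hI : IsOpen I) (hI' : I.OrdConnected)
    (hC : IsChebyshev I f g) (hm : IsMeasurableFamily I m) (hx : x ∈ cube d I) :
    ¬ (avg μ (fun y t => f (m y t)) x = 0 ∧ avg μ (fun y t => g (m y t)) x = 0) := by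
  rintro ⟨hA, hB⟩
  have : Nonempty (Fin d) := ⟨⟨0, hd⟩⟩
  obtain ⟨σ, hσ⟩ := hC.exists_sign hI'
  obtain ⟨i₀, hi₀⟩ := exists_eq_ciInf_of_finite (f := x)
  obtain ⟨p, hp, hpI⟩ : ∃ p < x i₀, p ∈ I := by
    have h1 : ∀ᶠ p in nhdsWithin (x i₀) (Iio (x i₀)), p ∈ I :=
      nhdsWithin_le_nhds (hI.mem_nhds (hx i₀))
    obtain ⟨p, hp⟩ := (h1.and self_mem_nhdsWithin).exists
    exact ⟨p, hp.2, hp.1⟩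
  have hpos : ∀ t, 0 < σ * chebDet f g (m x t) p := fun t =>
    hσ _ (hm.1 t x hx).1 _ hpI (hp.trans_le (hi₀ ▸ (hm.1 t x hx).2.1))
  have hint := (integrable_chebDet (μ := μ) hd hI hI' hC hm hx p).const_mul σ
  have h0 : ∫ t, σ * chebDet f g (m x t) p ∂μ = 0 := by
    rw [integral_const_mul, integral_chebDet hd hI hI' hC hm hx, hA, hB]
    simp
  rw [integral_eq_zero_iff_of_nonneg (fun t => (hpos t).le) hint] at h0
  obtain ⟨t, ht⟩ := h0.exists
  exact (hpos t).ne' ht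

theorem exists_integral_chebDet_eq_zero (hd : 1 ≤ d) (hI : IsOpen I) (hI' : I.OrdConnected)
    (hC : IsChebyshev I f g) (hm : IsMeasurableFamily I m) (hx : x ∈ cube d I) :
    ∃ y, y ∈ I ∧ ∫ t, chebDet f g (m x t) y ∂μ = 0 := by
  have : Nonempty (Fin d) := ⟨⟨0, hd⟩⟩
  obtain ⟨σ, hσ⟩ := hC.exists_sign hI'
  obtain ⟨i₀, hi₀⟩ := exists_eq_ciInf_of_finite (f := x)
  obtain ⟨i₁, hi₁⟩ := exists_eq_ciSup_of_finite (f := x)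
  have hle : x i₀ ≤ x i₁ := hi₁ ▸ le_ciSup (finite_range x).bddAbove i₀
  have hsub : Icc (x i₀) (x i₁) ⊆ I := hI'.out (hx i₀) (hx i₁)
  have hself : ∀ y, chebDet f g y y = 0 := fun y => by simp [chebDet]
  have hlo : 0 ≤ ∫ t, σ * chebDet f g (m x t) (x i₀) ∂μ := integral_nonneg fun t => by
    rcases (hi₀ ▸ (hm.1 t x hx).2.1 : x i₀ ≤ m x t).eq_or_lt with h | h
    · simp [← h, hself]
    · exact (hσ _ (hm.1 t x hx).1 _ (hx i₀) h).le
  have hhi : ∫ t, σ * chebDet f g (m x t) (x i₁) ∂μ ≤ 0 := integral_nonpos fun t => by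
    rcases (hi₁ ▸ (hm.1 t x hx).2.2 : m x t ≤ x i₁).eq_or_lt with h | h
    · simp [h, hself]
    · have := hσ _ (hx i₁) _ (hm.1 t x hx).1 h
      rw [chebDet_swap] at this
      simp only [Pi.zero_apply]
      linarith
  have hcont : ContinuousOn (fun y => ∫ t, σ * chebDet f g (m x t) y ∂μ) (Icc (x i₀) (x i₁)) := by
    simp only [integral_const_mul, integral_chebDet hd hI hI' hC hm hx]
    exact continuousOn_const.mul ((continuousOn_const.mul (hC.2.1.mono hsub)).sub
      ((hC.1.mono hsub).mul continuousOn_const))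
  obtain ⟨y, hy, hy0⟩ := intermediate_value_Icc' hle hcont ⟨hhi, hlo⟩
  refine ⟨y, hsub hy, ?_⟩
  rcases mul_eq_zero.1 ((integral_const_mul σ _).symm.trans hy0) with h | h
  · -- If `σ = 0` then `I` has no two distinct points, so all the values `m x t` equal `y`.
    have hall : ∀ t, m x t = y := fun t => by
      by_contra hne
      rcases lt_or_gt_of_ne hne with hlt | hlt
      · simpa [h] using hσ _ (hsub hy) _ (hm.1 t x hx).1 hlt
      · simpa [h] using hσ _ (hm.1 t x hx).1 _ (hsub hy) hlt
    simp [hall, hself]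
  · exact h

theorem eq_of_integral_chebDet_eq_zero (hd : 1 ≤ d) (hI : IsOpen I) (hI' : I.OrdConnected)
    (hC : IsChebyshev I f g) (hm : IsMeasurableFamily I m) (hx : x ∈ cube d I) {y z : ℝ}
    (hy : y ∈ I) (hz : z ∈ I) (hy0 : ∫ t, chebDet f g (m x t) y ∂μ = 0)
    (hz0 : ∫ t, chebDet f g (m x t) z ∂μ = 0) : y = z := by
  by_contra hne
  rw [integral_chebDet hd hI hI' hC hm hx] at hy0 hz0
  have hD := hC.2.2 y hy z hz hne
  refine avg_ne_zero (μ := μ) hd hI hI' hC hm hx ⟨?_, ?_⟩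
  · refine (mul_eq_zero.1 (?_ : _ * chebDet f g y z = 0)).resolve_right hD
    simp only [chebDet]
    linear_combination f y * hz0 - f z * hy0
  · refine (mul_eq_zero.1 (?_ : _ * chebDet f g y z = 0)).resolve_right hD
    simp only [chebDet]
    linear_combination g y * hz0 - g z * hy0

theorem genMean_spec (hd : 1 ≤ d) (hI : IsOpen I) (hI' : I.OrdConnected)
    (hC : IsChebyshev I f g) (hm : IsMeasurableFamily I m) (hx : x ∈ cube d I) :
    genMean I f g m μ x ∈ I ∧ ∫ t, chebDet f g (m x t) (genMean I f g m μ x) ∂μ = 0 :=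
  Classical.epsilon_spec (exists_integral_chebDet_eq_zero hd hI hI' hC hm hx)

theorem avg_mul_genMean (hd : 1 ≤ d) (hI : IsOpen I) (hI' : I.OrdConnected)
    (hC : IsChebyshev I f g) (hm : IsMeasurableFamily I m) (hx : x ∈ cube d I) :
    avg μ (fun y t => f (m y t)) x * g (genMean I f g m μ x) =
      avg μ (fun y t => g (m y t)) x * f (genMean I f g m μ x) := by
  have h := (genMean_spec (μ := μ) hd hI hI' hC hm hx).2
  rw [integral_chebDet hd hI hI' hC hm hx] at h
  linear_combination h

theorem genMean_diag (hd : 1 ≤ d) (hI : IsOpen I) (hI' : I.OrdConnected)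
    (hC : IsChebyshev I f g) (hm : IsMeasurableFamily I m) {x : ℝ} (hx : x ∈ I) :
    genMean I f g m μ (diag d x) = x := by
  obtain ⟨h1, h2⟩ := genMean_spec (μ := μ) hd hI hI' hC hm (diag_mem_cube hx)
  refine eq_of_integral_chebDet_eq_zero hd hI hI' hC hm (diag_mem_cube hx) h1 hx h2 ?_
  simp [hm.apply_diag hd hx, chebDet]

/-- The mean is as smooth as the averages of `f ∘ m` and `g ∘ m`: near each point it is the implicit
function determined by `⟨f ∘ m⟩ g(y) = ⟨g ∘ m⟩ f(y)`. The derivative of this equation in `y` is, up to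
a nonzero factor, the Wronski determinant of `(f, g)`. -/
theorem contDiffOn_genMean (hd : 1 ≤ d) (hI : IsOpen I) (hI' : I.OrdConnected) {n : ℕ} (hn : 1 ≤ n)
    (hfg : PairClass n I f g) (hm : IsMeasurableFamily I m)
    (hA : ContDiffOn ℝ n (avg μ fun y t => f (m y t)) (cube d I))
    (hB : ContDiffOn ℝ n (avg μ fun y t => g (m y t)) (cube d I)) :
    ContDiffOn ℝ n (genMean I f g m μ) (cube d I) := by
  intro x hx
  have hC := hfg.chebyshev
  have hU := (isOpen_cube hI).mem_nhds hx
  obtain ⟨hyI, -⟩ := genMean_spec (μ := μ) hd hI hI' hC hm hx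
  have hAB := avg_mul_genMean (μ := μ) hd hI hI' hC hm hx
  have hne := avg_ne_zero (μ := μ) hd hI hI' hC hm hx
  have hW := hfg.wronskian_ne_zero hn _ hyI
  have hn0 : ((n : ℕ) : WithTop ℕ∞) ≠ 0 := by exact_mod_cast (by omega : n ≠ 0)
  set y := genMean I f g m μ x with hy
  set A := avg μ fun y t => f (m y t) with hAdef
  set B := avg μ fun y t => g (m y t) with hBdef
  set H : (Fin d → ℝ) × ℝ → ℝ := fun q => A q.1 * g q.2 - f q.2 * B q.1 with hH
  have hfy := hfg.contDiff_left.contDiffAt (hI.mem_nhds hyI)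
  have hgy := hfg.contDiff_right.contDiffAt (hI.mem_nhds hyI)
  have cdH : ContDiffAt ℝ n H (x, y) := by
    have hA' : ContDiffAt ℝ n (fun q : (Fin d → ℝ) × ℝ => A q.1) (x, y) :=
      ContDiffAt.comp (g := A) (x, y) (hA.contDiffAt hU) contDiffAt_fst
    have hB' : ContDiffAt ℝ n (fun q : (Fin d → ℝ) × ℝ => B q.1) (x, y) :=
      ContDiffAt.comp (g := B) (x, y) (hB.contDiffAt hU) contDiffAt_fst
    have hf' : ContDiffAt ℝ n (fun q : (Fin d → ℝ) × ℝ => f q.2) (x, y) :=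
      ContDiffAt.comp (x, y) hfy contDiffAt_snd
    have hg' : ContDiffAt ℝ n (fun q : (Fin d → ℝ) × ℝ => g q.2) (x, y) :=
      ContDiffAt.comp (x, y) hgy contDiffAt_snd
    exact (hA'.mul hg').sub (hf'.mul hB')
  have hder : (fderiv ℝ H (x, y)) (0, 1) = A x * deriv g y - deriv f y * B x := by
    have h1 : HasDerivAt (fun s : ℝ => H (x, s)) (A x * deriv g y - deriv f y * B x) y :=
      ((hgy.differentiableAt hn0).hasDerivAt.const_mul (A x)).fun_sub
        ((hfy.differentiableAt hn0).hasDerivAt.mul_const (B x))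
    have h2 : HasDerivAt (fun s : ℝ => (x, s)) ((0 : Fin d → ℝ), (1 : ℝ)) y :=
      (hasDerivAt_const y x).prodMk (hasDerivAt_id y)
    exact ((cdH.differentiableAt hn0).hasFDerivAt.comp_hasDerivAt y h2).unique h1
  have hder0 : A x * deriv g y - deriv f y * B x ≠ 0 := by
    -- Were this zero, `(A x, B x)` would solve a homogeneous linear system whose determinant
    -- is the Wronski determinant.
    intro h0
    refine hne ⟨(mul_eq_zero.1 (?_ : _ * wronskian f g y = 0)).resolve_right hW,
      (mul_eq_zero.1 (?_ : _ * wronskian f g y = 0)).resolve_right hW⟩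
    · simp only [wronskian]
      linear_combination deriv f y * hAB - f y * h0
    · simp only [wronskian]
      linear_combination deriv g y * hAB - g y * h0
  have hinv : (fderiv ℝ H (x, y) ∘L .inr ℝ (Fin d → ℝ) ℝ).IsInvertible := by
    refine ⟨ContinuousLinearEquiv.unitsEquivAut ℝ (Units.mk0 _ hder0), ?_⟩
    ext
    simp [hder]
  have hH0 : H (x, y) = 0 := by simp only [hH]; linear_combination hAB
  have hψ := cdH.contDiffAt_implicitFunction hn0 hinv
  set ψ := cdH.implicitFunction hn0 hinv with hψdef
  have hψx : ψ x = y := cdH.implicitFunction_apply_self hn0 hinv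
  have heq : genMean I f g m μ =ᶠ[nhds x] ψ := by
    have h1 : ∀ᶠ z in nhds x, ψ z ∈ I :=
      hψ.continuousAt (hI.mem_nhds (by rw [hψx]; exact hyI))
    filter_upwards [hU, h1, cdH.eventually_apply_implicitFunction hn0 hinv] with z hz hzI hz0
    obtain ⟨hs1, hs2⟩ := genMean_spec (μ := μ) hd hI hI' hC hm hz
    refine eq_of_integral_chebDet_eq_zero hd hI hI' hC hm hz hs1 hzI hs2 ?_
    rw [integral_chebDet hd hI hI' hC hm hz, ← hH0, ← hz0]
  exact (hψ.congr_of_eventuallyEq heq).contDiffWithinAt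

end Mean

/-! ### Partial derivatives of the mean on the diagonal -/

section Diagonal

open Set

variable {I : Set ℝ} {f g : ℝ → ℝ} {x : ℝ}

theorem iteratedDeriv_two_eq (f : ℝ → ℝ) : iteratedDeriv 2 f = deriv (deriv f) := by
  rw [iteratedDeriv_succ, iteratedDeriv_one]

/-- The terms of `Φ' + Φ²` with the squared Wronski determinant as denominator cancel, because
`(f' g - f g')' = f'' g - f g''`. -/
theorem deriv_Phi_add_sq (hI : IsOpen I) (hf : ContDiffOn ℝ 3 f I) (hg : ContDiffOn ℝ 3 g I)
    (hx : x ∈ I) (hW : wronskian f g x ≠ 0) :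
    deriv (Phi f g) x + Phi f g x ^ 2 =
      (deriv (deriv (deriv f)) x * g x - f x * deriv (deriv (deriv g)) x +
        (deriv (deriv f) x * deriv g x - deriv f x * deriv (deriv g) x)) / wronskian f g x := by
  have key : ∀ k : ℝ → ℝ, ContDiffOn ℝ 3 k I → HasDerivAt k (deriv k x) x ∧
      HasDerivAt (deriv k) (deriv (deriv k) x) x ∧
      HasDerivAt (deriv (deriv k)) (deriv (deriv (deriv k)) x) x := fun k hk => by
    have hk1 : ContDiffOn ℝ 2 (deriv k) I := hk.deriv_of_isOpen hI (by norm_num)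
    have hk2 : ContDiffOn ℝ 1 (deriv (deriv k)) I := hk1.deriv_of_isOpen hI (by norm_num)
    have hn := hI.mem_nhds hx
    exact ⟨((hk.differentiableOn (by norm_num)).differentiableAt hn).hasDerivAt,
      ((hk1.differentiableOn (by norm_num)).differentiableAt hn).hasDerivAt,
      ((hk2.differentiableOn (by norm_num)).differentiableAt hn).hasDerivAt⟩
  obtain ⟨f0, f1, f2⟩ := key f hf
  obtain ⟨g0, g1, g2⟩ := key g hg
  have hWd : HasDerivAt (wronskian f g) _ x := (f1.fun_mul g0).fun_sub (f0.fun_mul g1)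
  have hN := (f2.fun_mul g0).fun_sub (f0.fun_mul g2)
  have hP : Phi f g = fun z => (deriv (deriv f) z * g z - f z * deriv (deriv g) z) /
      wronskian f g z := by
    funext z
    rw [Phi, iteratedDeriv_two_eq, iteratedDeriv_two_eq]
  rw [hP, (hN.fun_div hWd hW).deriv]
  field_simp
  ring

variable {T : Type*} [MeasurableSpace T] {μ : Measure T} [IsProbabilityMeasure μ]

theorem integral_centered_mul {X Y : T → ℝ} (hX : Integrable X μ) (hY : Integrable Y μ)
    (hXY : Integrable (fun t => X t * Y t) μ) :
    ∫ t, (X t - ∫ s, X s ∂μ) * (Y t - ∫ s, Y s ∂μ) ∂μ =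
      (∫ t, X t * Y t ∂μ) - (∫ t, X t ∂μ) * ∫ t, Y t ∂μ := by
  set a := ∫ s, X s ∂μ with ha
  set b := ∫ s, Y s ∂μ with hb
  have h1 : Integrable (fun t => X t * Y t - b * X t) μ := hXY.sub (hX.const_mul b)
  have h2 : Integrable (fun t => X t * Y t - b * X t - a * Y t) μ := h1.sub (hY.const_mul a)
  have e : ∀ t, (X t - a) * (Y t - b) = X t * Y t - b * X t - a * Y t + a * b := fun t => by ring
  simp only [e]
  rw [integral_add h2 (integrable_const _), integral_sub h1 (hY.const_mul a),
    integral_sub hXY (hX.const_mul b), integral_const_mul, integral_const_mul, ← ha, ← hb]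
  simp
  ring

theorem integral_centered_mul_mul {X Y Z : T → ℝ} (hX : Integrable X μ) (hY : Integrable Y μ)
    (hZ : Integrable Z μ) (hXY : Integrable (fun t => X t * Y t) μ)
    (hXZ : Integrable (fun t => X t * Z t) μ) (hYZ : Integrable (fun t => Y t * Z t) μ)
    (hXYZ : Integrable (fun t => X t * Y t * Z t) μ) :
    ∫ t, (X t - ∫ s, X s ∂μ) * (Y t - ∫ s, Y s ∂μ) * (Z t - ∫ s, Z s ∂μ) ∂μ =
      (∫ t, X t * Y t * Z t ∂μ) - (∫ t, X t ∂μ) * (∫ t, Y t * Z t ∂μ) -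
        (∫ t, Y t ∂μ) * (∫ t, X t * Z t ∂μ) - (∫ t, Z t ∂μ) * (∫ t, X t * Y t ∂μ) +
        2 * ((∫ t, X t ∂μ) * (∫ t, Y t ∂μ) * ∫ t, Z t ∂μ) := by
  set a := ∫ s, X s ∂μ with ha
  set b := ∫ s, Y s ∂μ with hb
  set c := ∫ s, Z s ∂μ with hc
  have h1 : Integrable (fun t => X t * Y t * Z t - a * (Y t * Z t)) μ := hXYZ.sub (hYZ.const_mul a)
  have h2 : Integrable (fun t => X t * Y t * Z t - a * (Y t * Z t) - b * (X t * Z t)) μ :=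
    h1.sub (hXZ.const_mul b)
  have h3 : Integrable (fun t => X t * Y t * Z t - a * (Y t * Z t) - b * (X t * Z t) -
    c * (X t * Y t)) μ := h2.sub (hXY.const_mul c)
  have h4 : Integrable (fun t => X t * Y t * Z t - a * (Y t * Z t) - b * (X t * Z t) -
    c * (X t * Y t) + b * c * X t) μ := h3.add (hX.const_mul _)
  have h5 : Integrable (fun t => X t * Y t * Z t - a * (Y t * Z t) - b * (X t * Z t) -
    c * (X t * Y t) + b * c * X t + a * c * Y t) μ := h4.add (hY.const_mul _)
  have h6 : Integrable (fun t => X t * Y t * Z t - a * (Y t * Z t) - b * (X t * Z t) -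
    c * (X t * Y t) + b * c * X t + a * c * Y t + a * b * Z t) μ := h5.add (hZ.const_mul _)
  have e : ∀ t, (X t - a) * (Y t - b) * (Z t - c) = X t * Y t * Z t - a * (Y t * Z t) -
      b * (X t * Z t) - c * (X t * Y t) + b * c * X t + a * c * Y t + a * b * Z t -
      a * b * c := fun t => by ring
  simp only [e]
  rw [integral_sub h6 (integrable_const _), integral_add h5 (hZ.const_mul _),
    integral_add h4 (hY.const_mul _), integral_add h3 (hX.const_mul _),
    integral_sub h2 (hXY.const_mul c), integral_sub h1 (hXZ.const_mul b),
    integral_sub hXYZ (hYZ.const_mul a)]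
  simp only [integral_const_mul, ← ha, ← hb, ← hc]
  simp
  ring

variable {d : ℕ} {m : (Fin d → ℝ) → T → ℝ}

theorem FamilyClass2.avg_pdStar_mul (hm : FamilyClass2 μ I m) (hx : x ∈ I) (i j : Fin d) :
    avg μ (fun y t => pdStar μ i m y t * pdStar μ j m y t) (diag d x) =
      avg μ (fun y t => pd i m y t * pd j m y t) (diag d x) -
        avg μ (pd i m) (diag d x) * avg μ (pd j m) (diag d x) := by
  have hp := diag_mem_cube (d := d) hx
  exact integral_centered_mul ((hm.type_one _ hp i).integrable hp)
    ((hm.type_one _ hp j).integrable hp)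
    (((hm.type_two _ hp i i).1.mul (hm.type_two _ hp j j).1 (s := 1)).integrable hp)

theorem FamilyClass3.avg_pdStar_mul_mul (hm : FamilyClass3 μ I m) (hx : x ∈ I) (i j l : Fin d) :
    avg μ (fun y t => pdStar μ i m y t * pdStar μ j m y t * pdStar μ l m y t) (diag d x) =
      avg μ (fun y t => pd i m y t * pd j m y t * pd l m y t) (diag d x) -
        avg μ (pd i m) (diag d x) * avg μ (fun y t => pd j m y t * pd l m y t) (diag d x) -
        avg μ (pd j m) (diag d x) * avg μ (fun y t => pd i m y t * pd l m y t) (diag d x) -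
        avg μ (pd l m) (diag d x) * avg μ (fun y t => pd i m y t * pd j m y t) (diag d x) +
        2 * (avg μ (pd i m) (diag d x) * avg μ (pd j m) (diag d x) *
          avg μ (pd l m) (diag d x)) := by
  have hp := diag_mem_cube (d := d) hx
  have h1 := fun i => (hm.type_one _ hp i).integrable hp
  have h2 := fun i j =>
    ((hm.type_two _ hp i i).1.mul (hm.type_two _ hp j j).1 (s := 1)).integrable hp
  have t1 := fun i => (hm.type_three _ hp i i i).1
  exact integral_centered_mul_mul (h1 i) (h1 j) (h1 l) (h2 i j) (h2 i l) (h2 j l)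
    ((((t1 i).mul (t1 j) (s := 3 / 2)).mul (t1 l) (s := 1)).integrable hp)

theorem FamilyClass1.contDiffOn_genMean (hd : 1 ≤ d) (hI : IsOpen I) (hI' : I.OrdConnected)
    (hfg : PairClass 1 I f g) (hm : FamilyClass1 μ I m) :
    ContDiffOn ℝ 1 (genMean I f g m μ) (cube d I) := by
  have hf : ContDiffOn ℝ 1 f I := hfg.contDiff_left
  have hg : ContDiffOn ℝ 1 g I := hfg.contDiff_right
  exact GenMean.contDiffOn_genMean hd hI hI' le_rfl hfg hm.family
    ((hm.hasL1Jet_comp hd hI hI' hf).contDiffOn_avg hI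
      (hm.family.contDiffOn_comp hf hm.contDiff_one))
    ((hm.hasL1Jet_comp hd hI hI' hg).contDiffOn_avg hI
      (hm.family.contDiffOn_comp hg hm.contDiff_one))

theorem FamilyClass2.contDiffOn_genMean (hd : 1 ≤ d) (hI : IsOpen I) (hI' : I.OrdConnected)
    (hfg : PairClass 2 I f g) (hm : FamilyClass2 μ I m) :
    ContDiffOn ℝ 2 (genMean I f g m μ) (cube d I) := by
  have hf : ContDiffOn ℝ 2 f I := hfg.contDiff_left
  have hg : ContDiffOn ℝ 2 g I := hfg.contDiff_right
  exact GenMean.contDiffOn_genMean hd hI hI' one_le_two hfg hm.family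
    ((hm.hasL1Jet_comp hd hI hI' hf).contDiffOn_avg hI
      (hm.family.contDiffOn_comp hf hm.contDiff_two))
    ((hm.hasL1Jet_comp hd hI hI' hg).contDiffOn_avg hI
      (hm.family.contDiffOn_comp hg hm.contDiff_two))

theorem FamilyClass3.contDiffOn_genMean (hd : 1 ≤ d) (hI : IsOpen I) (hI' : I.OrdConnected)
    (hfg : PairClass 3 I f g) (hm : FamilyClass3 μ I m) :
    ContDiffOn ℝ 3 (genMean I f g m μ) (cube d I) := by
  have hf : ContDiffOn ℝ 3 f I := hfg.contDiff_left
  have hg : ContDiffOn ℝ 3 g I := hfg.contDiff_right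
  exact GenMean.contDiffOn_genMean hd hI hI' (by norm_num) hfg hm.family
    ((hm.hasL1Jet_comp hd hI hI' hf).contDiffOn_avg hI
      (hm.family.contDiffOn_comp hf hm.contDiff_three))
    ((hm.hasL1Jet_comp hd hI hI' hg).contDiffOn_avg hI
      (hm.family.contDiffOn_comp hg hm.contDiff_three))

theorem PairClass.of_le {k n : ℕ} (h : PairClass n I f g) (hk : 1 ≤ k) (hkn : k ≤ n) :
    PairClass k I f g where
  chebyshev := h.chebyshev
  contDiff_left := h.contDiff_left.of_le (by exact_mod_cast hkn)
  contDiff_right := h.contDiff_right.of_le (by exact_mod_cast hkn)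
  wronskian_ne_zero _ := h.wronskian_ne_zero (hk.trans hkn)

theorem FamilyClass1.pderiv_genMean_diag (hd : 1 ≤ d) (hI : IsOpen I) (hI' : I.OrdConnected)
    (hfg : PairClass 1 I f g) (hm : FamilyClass1 μ I m) (hx : x ∈ I) (i : Fin d) :
    pderiv i (genMean I f g m μ) (diag d x) = avg μ (pd i m) (diag d x) := by
  have hf : ContDiffOn ℝ 1 f I := hfg.contDiff_left
  have hg : ContDiffOn ℝ 1 g I := hfg.contDiff_right
  have hU := isOpen_cube (d := d) hI
  have hp := diag_mem_cube (d := d) hx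
  have hC := hfg.chebyshev
  have hM := hm.contDiffOn_genMean hd hI hI' hfg
  have hMI : MapsTo (genMean I f g m μ) (cube d I) I := fun y hy =>
    (genMean_spec hd hI hI' hC hm.family hy).1
  have hA := fun {k : ℝ → ℝ} (hk : ContDiffOn ℝ 1 k I) =>
    (hm.hasL1Jet_comp hd hI hI' hk).contDiffOn_avg hI (hm.family.contDiffOn_comp hk hm.contDiff_one)
  have hdiff := fun {H : (Fin d → ℝ) → ℝ} (hH : ContDiffOn ℝ 1 H (cube d I)) =>
    (hH.differentiableOn one_ne_zero).differentiableAt (hU.mem_nhds hp)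
  -- The identity `⟨f ∘ m⟩ (g ∘ M) = ⟨g ∘ m⟩ (f ∘ M)`, differentiated and evaluated on the diagonal.
  have E := pderiv_eqOn hU (fun y hy => avg_mul_genMean (μ := μ) hd hI hI' hC hm.family hy) i hp
  rw [pderiv_mul (hdiff (hA hf)) (G := fun y => g (genMean I f g m μ y))
      (hdiff (hg.comp hM hMI)), pderiv_mul (hdiff (hA hg))
      (G := fun y => f (genMean I f g m μ y)) (hdiff (hf.comp hM hMI)),
    pderiv_comp_eqOn hU hI hg hM hMI i hp, pderiv_comp_eqOn hU hI hf hM hMI i hp,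
    hm.pderiv_avg_comp_diag hd hI hI' hf hx, hm.pderiv_avg_comp_diag hd hI hI' hg hx,
    avg_comp_diag hd hm.family hx, avg_comp_diag hd hm.family hx] at E
  simp only [genMean_diag hd hI hI' hC hm.family hx] at E
  have hW := hfg.wronskian_ne_zero le_rfl x hx
  refine mul_left_cancel₀ hW ?_
  simp only [wronskian]
  linear_combination -E

theorem FamilyClass2.pderiv_pderiv_genMean_diag (hd : 1 ≤ d) (hI : IsOpen I)
    (hI' : I.OrdConnected) (hfg : PairClass 2 I f g) (hm : FamilyClass2 μ I m) (hx : x ∈ I)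
    (i j : Fin d) :
    pderiv i (pderiv j (genMean I f g m μ)) (diag d x) =
      Phi f g x * avg μ (fun y t => pdStar μ i m y t * pdStar μ j m y t) (diag d x) +
        avg μ (pd i (pd j m)) (diag d x) := by
  have hf : ContDiffOn ℝ 2 f I := hfg.contDiff_left
  have hg : ContDiffOn ℝ 2 g I := hfg.contDiff_right
  have hf1 : ContDiffOn ℝ 1 f I := hf.of_le one_le_two
  have hg1 : ContDiffOn ℝ 1 g I := hg.of_le one_le_two
  have hU := isOpen_cube (d := d) hI
  have hp := diag_mem_cube (d := d) hx
  have hC := hfg.chebyshev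
  have hM := hm.contDiffOn_genMean hd hI hI' hfg
  have hM1 : ContDiffOn ℝ 1 (genMean I f g m μ) (cube d I) := hM.of_le one_le_two
  have hMI : MapsTo (genMean I f g m μ) (cube d I) I := fun y hy =>
    (genMean_spec hd hI hI' hC hm.family hy).1
  have hA := fun {k : ℝ → ℝ} (hk : ContDiffOn ℝ 2 k I) =>
    (hm.hasL1Jet_comp hd hI hI' hk).contDiffOn_avg hI (hm.family.contDiffOn_comp hk hm.contDiff_two)
  -- As in the first order case, starting from the second derivative of the defining identity.
  have E := pderiv_eqOn hU (pderiv_eqOn hU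
    (fun y hy => avg_mul_genMean (μ := μ) hd hI hI' hC hm.family hy) j) i hp
  rw [pderiv_pderiv_mul_eqOn hU (hA hf) (G := fun y => g (genMean I f g m μ y))
      (hg.comp hM hMI) i j hp, pderiv_pderiv_mul_eqOn hU (hA hg)
      (G := fun y => f (genMean I f g m μ y)) (hf.comp hM hMI) i j hp] at E
  simp only [pderiv_pderiv_comp_eqOn hU hI hg hM hMI _ _ hp,
    pderiv_pderiv_comp_eqOn hU hI hf hM hMI _ _ hp, pderiv_comp_eqOn hU hI hg1 hM1 hMI _ hp,
    pderiv_comp_eqOn hU hI hf1 hM1 hMI _ hp, avg_comp_diag hd hm.family hx,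
    hm.pderiv_avg_comp_diag hd hI hI' hf1 hx, hm.pderiv_avg_comp_diag hd hI hI' hg1 hx,
    hm.pderiv_pderiv_avg_comp_diag hd hI hI' hf hx, hm.pderiv_pderiv_avg_comp_diag hd hI hI' hg hx,
    genMean_diag hd hI hI' hC hm.family hx,
    hm.pderiv_genMean_diag hd hI hI' (hfg.of_le le_rfl one_le_two) hx] at E
  have hW := hfg.wronskian_ne_zero one_le_two x hx
  rw [hm.avg_pdStar_mul hx, Phi, iteratedDeriv_two_eq, iteratedDeriv_two_eq]
  field_simp
  simp only [wronskian]
  linear_combination -E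

theorem FamilyClass3.pderiv_pderiv_pderiv_genMean_diag (hd : 1 ≤ d) (hI : IsOpen I)
    (hI' : I.OrdConnected) (hfg : PairClass 3 I f g) (hm : FamilyClass3 μ I m) (hx : x ∈ I)
    (i j l : Fin d) :
    pderiv i (pderiv j (pderiv l (genMean I f g m μ))) (diag d x) =
      (deriv (Phi f g) x + Phi f g x ^ 2) *
          (avg μ (fun y t => pd i m y t * pd j m y t * pd l m y t) (diag d x)
            - avg μ (pd i m) (diag d x) * avg μ (pd j m) (diag d x)
                * avg μ (pd l m) (diag d x))
        + Phi f g x * cyclicSum (fun α β γ =>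
            avg μ (fun y t => pd α (pd β m) y t * pd γ m y t) (diag d x)
              - pderiv α (pderiv β (genMean I f g m μ)) (diag d x)
                * pderiv γ (genMean I f g m μ) (diag d x)) i j l
        + Psi f g x * avg μ
            (fun y t => pdStar μ i m y t * pdStar μ j m y t * pdStar μ l m y t) (diag d x)
        + avg μ (pd i (pd j (pd l m))) (diag d x) := by
  have h23 : (2 : WithTop ℕ∞) ≤ 3 := by norm_num
  have hf : ContDiffOn ℝ 3 f I := hfg.contDiff_left
  have hg : ContDiffOn ℝ 3 g I := hfg.contDiff_right
  have hf2 : ContDiffOn ℝ 2 f I := hf.of_le h23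
  have hg2 : ContDiffOn ℝ 2 g I := hg.of_le h23
  have hf1 : ContDiffOn ℝ 1 f I := hf2.of_le one_le_two
  have hg1 : ContDiffOn ℝ 1 g I := hg2.of_le one_le_two
  have hU := isOpen_cube (d := d) hI
  have hp := diag_mem_cube (d := d) hx
  have hC := hfg.chebyshev
  have hM := hm.contDiffOn_genMean hd hI hI' hfg
  have hM2 : ContDiffOn ℝ 2 (genMean I f g m μ) (cube d I) := hM.of_le h23
  have hM1 : ContDiffOn ℝ 1 (genMean I f g m μ) (cube d I) := hM2.of_le one_le_two
  have hMI : MapsTo (genMean I f g m μ) (cube d I) I := fun y hy =>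
    (genMean_spec hd hI hI' hC hm.family hy).1
  have hA := fun {k : ℝ → ℝ} (hk : ContDiffOn ℝ 3 k I) =>
    (hm.hasL1Jet_comp hd hI hI' hk).contDiffOn_avg hI
      (hm.family.contDiffOn_comp hk hm.contDiff_three)
  have E := pderiv_eqOn hU (pderiv_eqOn hU (pderiv_eqOn hU
    (fun y hy => avg_mul_genMean (μ := μ) hd hI hI' hC hm.family hy) l) j) i hp
  rw [pderiv_pderiv_pderiv_mul_eqOn hU (hA hf) (G := fun y => g (genMean I f g m μ y))
      (hg.comp hM hMI) i j l hp, pderiv_pderiv_pderiv_mul_eqOn hU (hA hg)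
      (G := fun y => f (genMean I f g m μ y)) (hf.comp hM hMI) i j l hp] at E
  simp only [pderiv_pderiv_pderiv_comp_eqOn hU hI hg hM hMI _ _ _ hp,
    pderiv_pderiv_pderiv_comp_eqOn hU hI hf hM hMI _ _ _ hp,
    pderiv_pderiv_comp_eqOn hU hI hg2 hM2 hMI _ _ hp,
    pderiv_pderiv_comp_eqOn hU hI hf2 hM2 hMI _ _ hp, pderiv_comp_eqOn hU hI hg1 hM1 hMI _ hp,
    pderiv_comp_eqOn hU hI hf1 hM1 hMI _ hp, avg_comp_diag hd hm.family hx,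
    hm.pderiv_avg_comp_diag hd hI hI' hf1 hx, hm.pderiv_avg_comp_diag hd hI hI' hg1 hx,
    hm.pderiv_pderiv_avg_comp_diag hd hI hI' hf2 hx,
    hm.pderiv_pderiv_avg_comp_diag hd hI hI' hg2 hx,
    hm.pderiv_pderiv_pderiv_avg_comp_diag hd hI hI' hf hx,
    hm.pderiv_pderiv_pderiv_avg_comp_diag hd hI hI' hg hx,
    genMean_diag hd hI hI' hC hm.family hx,
    hm.pderiv_genMean_diag hd hI hI' (hfg.of_le le_rfl (by norm_num)) hx] at E
  have hW := hfg.wronskian_ne_zero (by norm_num) x hx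
  rw [deriv_Phi_add_sq hI hf hg hx hW]
  simp only [hm.avg_pdStar_mul_mul hx, cyclicSum, Phi, Psi, iteratedDeriv_two_eq,
    hm.pderiv_genMean_diag hd hI hI' (hfg.of_le le_rfl (by norm_num)) hx]
  field_simp
  simp only [wronskian]
  -- The terms of the cyclic sum that involve mixed derivatives of `M` come from `k'' (∂∂M ∂M)` with
  -- `k = f, g`. The products of first and second derivatives carrying `f' g'` are common to both
  -- sides of `E` and drop out.
  linear_combination -E

end Diagonal

end GenMean

open GenMean in
theorem mainTheorem3 {T : Type*} [MeasurableSpace T] (μ : Measure T) [IsProbabilityMeasure μ]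
    (d : ℕ) (hd : 1 ≤ d)
    (I : Set ℝ) (hI_open : IsOpen I) (hI_interval : I.OrdConnected) (hI_nonempty : I.Nonempty)
    (f g : ℝ → ℝ) (m : (Fin d → ℝ) → T → ℝ) :
    (PairClass 1 I f g → FamilyClass1 μ I m →
      ContDiffOn ℝ 1 (genMean I f g m μ) (cube d I) ∧
      ∀ i, ∀ x ∈ I,
        pderiv i (genMean I f g m μ) (diag d x) = avg μ (pd i m) (diag d x)) ∧
    (PairClass 2 I f g → FamilyClass2 μ I m →
      ContDiffOn ℝ 2 (genMean I f g m μ) (cube d I) ∧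
      ∀ i j, ∀ x ∈ I,
        pderiv i (pderiv j (genMean I f g m μ)) (diag d x) =
          Phi f g x * avg μ (fun y t => pdStar μ i m y t * pdStar μ j m y t) (diag d x)
            + avg μ (pd i (pd j m)) (diag d x)) ∧
    (PairClass 3 I f g → FamilyClass3 μ I m →
      ContDiffOn ℝ 3 (genMean I f g m μ) (cube d I) ∧
      ∀ i j l, ∀ x ∈ I,
        pderiv i (pderiv j (pderiv l (genMean I f g m μ))) (diag d x) =
          (deriv (Phi f g) x + Phi f g x ^ 2) *
              (avg μ (fun y t => pd i m y t * pd j m y t * pd l m y t) (diag d x)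
                - avg μ (pd i m) (diag d x) * avg μ (pd j m) (diag d x)
                    * avg μ (pd l m) (diag d x))
            + Phi f g x * cyclicSum (fun α β γ =>
                avg μ (fun y t => pd α (pd β m) y t * pd γ m y t) (diag d x)
                  - pderiv α (pderiv β (genMean I f g m μ)) (diag d x)
                    * pderiv γ (genMean I f g m μ) (diag d x)) i j l
            + Psi f g x * avg μ
                (fun y t => pdStar μ i m y t * pdStar μ j m y t * pdStar μ l m y t) (diag d x)
            + avg μ (pd i (pd j (pd l m))) (diag d x)) := by
  refine ⟨fun hfg hm => ⟨hm.contDiffOn_genMean hd hI_open hI_interval hfg, fun i x hx => ?_⟩,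
    fun hfg hm => ⟨hm.contDiffOn_genMean hd hI_open hI_interval hfg, fun i j x hx => ?_⟩,
    fun hfg hm => ⟨hm.contDiffOn_genMean hd hI_open hI_interval hfg, fun i j l x hx => ?_⟩⟩
  · exact hm.pderiv_genMean_diag hd hI_open hI_interval hfg hx i
  · exact hm.pderiv_pderiv_genMean_diag hd hI_open hI_interval hfg hx i j
  · exact hm.pderiv_pderiv_pderiv_genMean_diag hd hI_open hI_interval hfg hx i j l
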